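/- **Setting.** Let $D_x$ be a probability distribution of prompts $x$ on a measurable space, let $\nu$ be a $\sigma$-finite base measure on the space of responses $y$, and let $\pi_\theta(y\mid x)$, $\theta\in\mathbb{R}^d$, and $\pi_{\mathrm{ref}}(y\mid x)$ be jointly measurable, strictly positive conditional probability densities with respect to $\nu$. Let $r(x,y)$, $c(x,y)$ be measurable real functions (reward and cost), $\beta,\kappa\in\mathbb{R}$, $\lambda\ge 0$, $N\ge1$, and $\alpha_1,\dots,\alpha_N\in(0,1)$. Write $\mathbb{E}_\theta$ for the expectation over $x\sim D_x$, $y\sim\pi_\theta(\cdot\mid x)$; $C_\pi$ for the cost $c(x,y)$ under $x\sim D_x$, $y\sim\pi(\cdot\mid x)$; $F_\theta$ for the distribution function of $C_{\pi_\theta}$; $Q_\mu(u)=\inf\{t: u\le F_\mu(t)\}$ for the quantile function of a law $\mu$; $q_i(\pi)=Q_{C_\pi}(\alpha_i)$ for the cost-quantile particles; $\hat\mu(p)=\frac1N\sum_i\delta_{p_i}$ for $p\in\mathbb{R}^N$; and $\tilde r=r-\beta\log(\pi_\theta/\pi_{\mathrm{ref}})$. Put $q'=q(\pi_{\mathrm{ref}})$.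 For $\chi>0$ let $$\Phi_\chi(p)=\mathcal L^\chi_{\mathrm{FSD}}(p)=\min_{P}\Big\{\sum_{i,j}P_{ij}\,(q'_j-p_i)_+ +\chi\sum_{i,j}P_{ij}\log P_{ij}\Big\},$$ the minimum being over nonnegative $N\times N$ matrices $P$ whose row and column sums are all $1/N$. Let $w\ge0$ on $[0,1]$ with $\int_0^1w=1$, and let $$\Psi(p)=\mathcal L^w_{\mathrm{FSD}}(\hat\mu(p),\hat\mu(q'))=\int_0^1 w(u)\,\big(Q_{\hat\mu(q')}(u)-Q_{\hat\mu(p)}(u)\big)_+\,du$$ (the unweighted objective $\mathcal L_{\mathrm{FSD}}$ is the case $w\equiv1$). For a function $\Theta$ of the particles, the corresponding particle Lagrangian is $$L_\Theta(\theta,\lambda)=\mathbb{E}_\theta[\tilde r]+\lambda\big(\Theta(q(\pi_\theta))-\kappa\big).$$ Fix $\theta_0$ and write $q=q(\pi_{\theta_0})$. Assume that $r$ and $\log(\pi_{\theta_0}/\pi_{\mathrm{ref}})$ are integrable under $\mathbb{E}_{\theta_0}$; that for $D_x\otimes\nu$-almost every $(x,y)$, for all $\theta$ in a neighbourhood of $\theta_0$,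 $\theta\mapsto\pi_\theta(y\mid x)$ is differentiable and $\|\nabla_\theta\pi_\theta(y\mid x)\|\,\big(1+|r|+|\log(\pi_\theta/\pi_{\mathrm{ref}})|\big)$ is at most a fixed $D_x\otimes\nu$-integrable function of $(x,y)$; and that $q_i\neq q'_j$ for all $i,j$. For $g\in\mathbb{R}^N$ define, at $\theta=\theta_0$, the REINFORCE expression and the density-free gradient $$E(g)=\mathbb{E}_{\theta_0}\Big[\Big(\tilde r(x,y)+\lambda\sum_{i=1}^N(-g_i)\,\mathbf 1(c(x,y)\le q_i)\Big)\nabla_\theta\log\pi_\theta(y\mid x)\Big],$$ $$G(g)=\nabla_\theta\mathbb{E}_\theta[\tilde r]-\lambda\sum_{i=1}^N g_i\,\nabla_\theta F_\theta(t)\big|_{t=q_i}.$$ Thus $G(g)$ is the chain-rule gradient with particle gradient $g$, in which the quantile gradient $\nabla_\theta q_i=-\nabla_\theta F_\theta(q_i)/f_\theta(q_i)$ is replaced by $-\nabla_\theta F_\theta(q_i)$. **Theorem 1.** 1. $\theta\mapsto\mathbb{E}_\theta[\tilde r]$ and $\theta\mapsto F_\theta(q_i)$ are differentiable at $\theta_0$,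 $\Phi_\chi$ is differentiable at $q$ for every $\chi>0$, and the random vector inside $E(g)$ is integrable for every $g\in\mathbb{R}^N$. 2. (Policy-gradient formula.) For every $\chi>0$, with particle gradient $\partial\Phi_\chi/\partial q_i$, the density-free gradient has the REINFORCE form: $G\big((\partial\Phi_\chi/\partial q_i)_i\big)=E\big((\partial\Phi_\chi/\partial q_i)_i\big)$, i.e. it equals $$\mathbb{E}_{\theta_0}\Big[\Big(\tilde r+\lambda\sum_{i=1}^N\Big(-\frac{\partial\mathcal L^\chi_{\mathrm{FSD}}}{\partial q_i}\Big)\mathbf 1(c(x,y)\le q_i)\Big)\nabla_\theta\log\pi_\theta(y\mid x)\Big];$$ with the weighted particle gradient $w(\alpha_i)\,\partial\Phi_\chi/\partial q_i$ the same holds with the additional factor $w(\alpha_i)$ on the $i$th summand. 3. (Exact gradients, and the error of dropping the density.) Suppose that for every $i$ the function $F_{\theta_0}$ has a derivative $f_i>0$ at $q_i$. Then $\nabla_\theta q_i(\pi_\theta)=-f_i^{-1}\nabla_\theta F_\theta(t)|_{t=q_i}$ at $\theta_0$; for every $\chi>0$ the particle Lagrangian $L_{\Phi_\chi}(\cdot,\lambda)$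 is differentiable at $\theta_0$ with gradient $E\big((f_i^{-1}\partial\Phi_\chi/\partial q_i)_i\big)$, and $$\nabla_\theta L_{\Phi_\chi}(\theta_0,\lambda)-E\big((\partial\Phi_\chi/\partial q_i)_i\big)=\lambda\sum_{i=1}^N\frac{\partial\Phi_\chi}{\partial q_i}\,\big(1-f_i^{-1}\big)\,\nabla_\theta F_\theta(t)\big|_{t=q_i}.$$ If moreover $q_1<\dots<q_N$, then $L_\Psi(\cdot,\lambda)$ is differentiable at $\theta_0$ with gradient $E\big((f_i^{-1}\partial\Psi/\partial q_i)_i\big)$. 4. (Weighted objective, vanishing regularization.) If $q_1<\dots<q_N$, then $\Psi$ is differentiable at $q$, and as $\chi\downarrow0$ the weighted REINFORCE expression $E\big((w(\alpha_i)\,\partial\Phi_\chi/\partial q_i)_i\big)$ converges to the density-free gradient of the weighted objective, up to the error of replacing the cell averages of $w$ by its values at the levels; that is, it converges to $$G\big((\partial\Psi/\partial q_i)_i\big)+\lambda\sum_{i=1}^N\Big(\frac{w(\alpha_i)}N-\int_{(i-1)/N}^{i/N}w(u)\,du\Big)\mathbf 1(q_i<q'_i)\,\nabla_\theta F_\theta(t)\big|_{t=q_i}.$$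 -/

import Mathlib

open MeasureTheory ProbabilityTheory Filter Topology

namespace RAD

/-! ### Quantiles, stochastic dominance, empirical measures -/

/-- The (left-continuous) quantile function `Q_μ(a) = inf {t | a ≤ F_μ(t)}` of a law `μ` on `ℝ`. -/
noncomputable def quantile (μ : Measure ℝ) (a : ℝ) : ℝ :=
  sInf {t : ℝ | a ≤ cdf μ t}

/-- The quantile-weighted first-order-dominance objective
`∫₀¹ w(u) (Q_Y(u) - Q_X(u))₊ du` between the laws `μ` of `X` and `ρ` of `Y`
(the unweighted objective is the case `w = 1`). -/
noncomputable def weightedFSD (w : ℝ → ℝ) (μ ρ : Measure ℝ) : ℝ :=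
  ∫ u in (0 : ℝ)..1, w u * max (quantile ρ u - quantile μ u) 0

/-- The empirical measure `N⁻¹ ∑ᵢ δ_{qᵢ}` of a vector of particles. -/
noncomputable def empirical {N : ℕ} (q : Fin N → ℝ) : Measure ℝ :=
  (N : ENNReal)⁻¹ • ∑ i, Measure.dirac (q i)

/-! ### Entropic optimal transport -/

/-- Admissible transport plans with marginals `a` and `b`. -/
def couplings {N M : ℕ} (a : Fin N → ℝ) (b : Fin M → ℝ) : Set (Matrix (Fin N) (Fin M) ℝ) :=
  {P | (∀ i j, 0 ≤ P i j) ∧ (∀ i, ∑ j, P i j = a i) ∧ (∀ j, ∑ i, P i j = b j)}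

/-- The entropy `H(P) = -∑ᵢⱼ Pᵢⱼ log Pᵢⱼ` (with `0 log 0 = 0`). -/
noncomputable def planEntropy {N M : ℕ} (P : Matrix (Fin N) (Fin M) ℝ) : ℝ :=
  -∑ i, ∑ j, P i j * Real.log (P i j)

/-- Entropically regularised optimal transport value `min_P ⟨P, C⟩ - χ H(P)`. -/
noncomputable def entropicOT {N M : ℕ} (χ : ℝ) (a : Fin N → ℝ) (b : Fin M → ℝ)
    (C : Matrix (Fin N) (Fin M) ℝ) : ℝ :=
  sInf ((fun P : Matrix (Fin N) (Fin M) ℝ =>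
    (∑ i, ∑ j, P i j * C i j) - χ * planEntropy P) '' couplings a b)

/-- The entropic dominance objective between the uniform empirical measures carried by the
particles `q` and `q'`, for the ground cost `(y - x)₊`, as a function of the particles. -/
noncomputable def entropicFSD {N : ℕ} (χ : ℝ) (q q' : Fin N → ℝ) : ℝ :=
  entropicOT χ (fun _ : Fin N => (N : ℝ)⁻¹) (fun _ : Fin N => (N : ℝ)⁻¹)
    (Matrix.of fun i j => max (q' j - q i) 0)

/-- The partial derivative `∂Φ/∂qᵢ` of a function of the particles. -/
noncomputable def particleDeriv {N : ℕ} (Φ : (Fin N → ℝ) → ℝ) (q : Fin N → ℝ) (i : Fin N) : ℝ :=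
  deriv (fun s => Φ (Function.update q i s)) (q i)

/-! ### Policies -/

/-- A stochastic policy: for every prompt `x` a positive probability density `y ↦ π(y ∣ x)`
with respect to a fixed base measure `ν` on responses (the counting measure when the responses
form a countable set). -/
structure Policy (𝒳 : Type*) {𝒴 : Type*} [MeasurableSpace 𝒳] [MeasurableSpace 𝒴]
    (ν : Measure 𝒴) where
  /-- the density `π(y ∣ x)` -/
  dens : 𝒳 → 𝒴 → ℝ
  measurable_dens : Measurable (Function.uncurry dens)
  dens_pos : ∀ x y, 0 < dens x y
  integral_dens : ∀ x, ∫ y, dens x y ∂ν = 1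

/-- The data of the dominance-constrained alignment problem: prompts, responses, a policy family
with parameter `θ ∈ ℝᵈ`, a reference policy, reward and cost models, the coefficient `β` of the
KL penalty, the constraint level `κ`, and `N` quantile levels in `(0,1)`. -/
structure Problem (d N : ℕ) (𝒳 𝒴 : Type*) [MeasurableSpace 𝒳] [MeasurableSpace 𝒴] where
  /-- the distribution of prompts -/
  prompts : Measure 𝒳
  prompts_prob : IsProbabilityMeasure prompts
  /-- the base measure on responses -/
  base : Measure 𝒴
  base_sigmaFinite : SigmaFinite base
  /-- the policy family `θ ↦ π_θ` -/
  policy : EuclideanSpace ℝ (Fin d) → Policy 𝒳 base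
  /-- the reference policy -/
  ref : Policy 𝒳 base
  /-- the reward model -/
  reward : 𝒳 → 𝒴 → ℝ
  measurable_reward : Measurable (Function.uncurry reward)
  /-- the cost model -/
  cost : 𝒳 → 𝒴 → ℝ
  measurable_cost : Measurable (Function.uncurry cost)
  /-- the coefficient of the KL penalty -/
  β : ℝ
  /-- the constraint level -/
  κ : ℝ
  /-- the quantile levels -/
  level : Fin N → ℝ
  level_mem : ∀ i, level i ∈ Set.Ioo (0 : ℝ) 1

namespace Problem

variable {d N : ℕ} {𝒳 𝒴 : Type*} [MeasurableSpace 𝒳] [MeasurableSpace 𝒴]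

/-- The joint law of `(x, y)` for a random prompt `x` and `y ∼ π(· ∣ x)`. -/
noncomputable def joint (S : Problem d N 𝒳 𝒴) (p : Policy 𝒳 S.base) : Measure (𝒳 × 𝒴) :=
  (S.prompts.prod S.base).withDensity fun z => ENNReal.ofReal (p.dens z.1 z.2)

/-- The law of the cost `C_π = c(x, y)`. -/
noncomputable def costLaw (S : Problem d N 𝒳 𝒴) (p : Policy 𝒳 S.base) : Measure ℝ :=
  (S.joint p).map fun z => S.cost z.1 z.2

/-- The cost-quantile particles `qᵢ(π) = Q_{C_π}(αᵢ)`. -/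
noncomputable def particles (S : Problem d N 𝒳 𝒴) (p : Policy 𝒳 S.base) : Fin N → ℝ :=
  fun i => quantile (S.costLaw p) (S.level i)

/-- `log (π_θ(y ∣ x) / π_ref(y ∣ x))`. -/
noncomputable def logRatio (S : Problem d N 𝒳 𝒴) (θ : EuclideanSpace ℝ (Fin d)) (z : 𝒳 × 𝒴) : ℝ :=
  Real.log ((S.policy θ).dens z.1 z.2 / S.ref.dens z.1 z.2)

/-- The KL-regularised reward `r̃(x, y) = r(x, y) - β log (π_θ(y ∣ x) / π_ref(y ∣ x))`. -/
noncomputable def regReward (S : Problem d N 𝒳 𝒴) (θ : EuclideanSpace ℝ (Fin d)) (z : 𝒳 × 𝒴) :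
    ℝ :=
  S.reward z.1 z.2 - S.β * S.logRatio θ z

/-- `E_{x, y ∼ π_θ}[r̃(x, y)]`. -/
noncomputable def expectedReward (S : Problem d N 𝒳 𝒴) (θ : EuclideanSpace ℝ (Fin d)) : ℝ :=
  ∫ z, S.regReward θ z ∂(S.joint (S.policy θ))

/-- The score `∇_θ log π_θ(y ∣ x)`. -/
noncomputable def score (S : Problem d N 𝒳 𝒴) (θ : EuclideanSpace ℝ (Fin d)) (z : 𝒳 × 𝒴) :
    EuclideanSpace ℝ (Fin d) :=
  gradient (fun θ' => Real.log ((S.policy θ').dens z.1 z.2)) θ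

/-- `∇_θ F_θ(t)` at `t = qᵢ(π_θ)`: the level `t` is frozen while the parameter is differentiated. -/
noncomputable def cdfGradient (S : Problem d N 𝒳 𝒴) (θ : EuclideanSpace ℝ (Fin d)) (i : Fin N) :
    EuclideanSpace ℝ (Fin d) :=
  gradient (fun θ' => cdf (S.costLaw (S.policy θ')) (S.particles (S.policy θ) i)) θ

/-- The Lagrangian `E[r̃] + lam (Φ(q(π_θ)) - κ)` in which the dominance term is a function `Φ` of
the cost-quantile particles. -/
noncomputable def lagrangian (S : Problem d N 𝒳 𝒴) (Φ : (Fin N → ℝ) → ℝ) (lam : ℝ)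
    (θ : EuclideanSpace ℝ (Fin d)) : ℝ :=
  S.expectedReward θ + lam * (Φ (S.particles (S.policy θ)) - S.κ)

/-- The density-free approximation of the gradient of the Lagrangian: in the chain rule
`∇E[r̃] + lam ∑ᵢ gᵢ ∇qᵢ(π_θ)` with particle gradient `g`, each quantile gradient
`∇qᵢ(π_θ) = -∇F_θ(qᵢ) / f_θ(qᵢ)` is replaced by `-∇F_θ(qᵢ)`. -/
noncomputable def densityFreeGradient (S : Problem d N 𝒳 𝒴) (lam : ℝ) (g : Fin N → ℝ)
    (θ : EuclideanSpace ℝ (Fin d)) : EuclideanSpace ℝ (Fin d) :=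
  gradient S.expectedReward θ + lam • ∑ i, g i • (-S.cdfGradient θ i)

/-- The random vector
`(r̃(x, y) + lam ∑ᵢ (-gᵢ) 1(c(x, y) ≤ qᵢ(π_θ))) ∇_θ log π_θ(y ∣ x)`. -/
noncomputable def estimatorIntegrand (S : Problem d N 𝒳 𝒴) (lam : ℝ) (g : Fin N → ℝ)
    (θ : EuclideanSpace ℝ (Fin d)) (z : 𝒳 × 𝒴) : EuclideanSpace ℝ (Fin d) :=
  (S.regReward θ z + lam * ∑ i, (-g i) *
    (if S.cost z.1 z.2 ≤ S.particles (S.policy θ) i then (1 : ℝ) else 0)) • S.score θ z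

/-- The REINFORCE-form expression: the expectation of the above over a random prompt and
`y ∼ π_θ(· ∣ x)`. -/
noncomputable def estimator (S : Problem d N 𝒳 𝒴) (lam : ℝ) (g : Fin N → ℝ)
    (θ : EuclideanSpace ℝ (Fin d)) : EuclideanSpace ℝ (Fin d) :=
  ∫ z, S.estimatorIntegrand lam g θ z ∂(S.joint (S.policy θ))

/-- Regularity of the policy family at `θ₀`: reward and log-ratio are integrable, and near `θ₀`
the densities are differentiable in the parameter with an integrable envelope. -/
structure RegularAt (S : Problem d N 𝒳 𝒴) (θ₀ : EuclideanSpace ℝ (Fin d)) : Prop where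
  integrable_reward :
    Integrable (fun z : 𝒳 × 𝒴 => S.reward z.1 z.2) (S.joint (S.policy θ₀))
  integrable_logRatio : Integrable (S.logRatio θ₀) (S.joint (S.policy θ₀))
  dominated : ∃ ε > 0, ∃ G : 𝒳 × 𝒴 → ℝ, Integrable G (S.prompts.prod S.base) ∧
    ∀ᵐ z ∂(S.prompts.prod S.base), ∀ θ ∈ Metric.ball θ₀ ε,
      DifferentiableAt ℝ (fun θ' => (S.policy θ').dens z.1 z.2) θ ∧
      ‖gradient (fun θ' => (S.policy θ').dens z.1 z.2) θ‖ *
        (1 + |S.reward z.1 z.2| + |S.logRatio θ z|) ≤ G z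

end Problem

end RAD

/-! The REINFORCE identity has nothing to do with transport. Differentiation under the integral
gives `∇F_θ(t) = ∫_{c ≤ t} ∇π` and `∇E[r̃] = ∫ r̃ ∇π`; the extra term `-β ∫ ∇π` from the log-ratio
vanishes because total mass is constant. Since `π ∇log π = ∇π`, `densityFreeGradient_eq_estimator`
holds for every particle gradient `g`.

For the exact gradients, the quantile is handled through the equivalence `Q ≤ t ↔ α ≤ F(t)`. Joint
differentiability of `(θ, t) ↦ F_θ(t)` is not needed: by `RegularAt.cdf_increment` the mixed
increment of `F` is `o(‖θ - θ₀‖)` as `t` approaches a non-atom, and `hasFDerivAt_generalizedInverse`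
converts this into a derivative of the quantile.

For `Φ_χ`, strong convexity of `x log x` on `[0,1]` makes the transport objective grow quadratically
away from its minimiser. The optimal value is therefore differentiable in the cost matrix, with the
optimal plan as derivative (`abs_entropicOT_sub_le`). The cost is affine in the particles near `q`,
as no `q i` sits at a kink `q' j`. Hence `∂Φ_χ/∂q_i` is minus the mass that row `i` sends to targets
above `q i`.

As `χ ↓ 0`, the optimal plan is within `χ N²` of optimal for the unregularised cost. The monotone
coupling is optimal for all sorted particles, in particular when coordinate `i` of `q` is moved by a
fixed `±s`; comparing the two plans there puts the row mass within `χ N² / s` of `N⁻¹ 1(q_i <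
q'_i)`. The plans themselves need not converge. On sorted particles `Ψ` is an explicit sum weighted
by cell integrals of `w`, which yields the correction term. -/

namespace RAD

/-! ### Differentiation under the integral sign, in gradient form -/

section ParametricIntegral

variable {d : ℕ} {Z : Type*} [MeasurableSpace Z] {m : Measure Z}

/-- Each directional component is an a.e. limit of difference quotients with step `1/(n+1)`, so
measurability of the gradient need not be assumed. -/
theorem aestronglyMeasurable_of_hasGradientAt {F : EuclideanSpace ℝ (Fin d) → Z → ℝ}
    {θ₀ : EuclideanSpace ℝ (Fin d)} {F' : Z → EuclideanSpace ℝ (Fin d)}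
    (hF : ∀ θ, AEStronglyMeasurable (F θ) m)
    (hd : ∀ᵐ z ∂m, HasGradientAt (fun θ => F θ z) (F' z) θ₀) :
    AEStronglyMeasurable F' m := by
  have key : ∀ v : EuclideanSpace ℝ (Fin d),
      AEStronglyMeasurable (fun z => inner ℝ v (F' z)) m := by
    intro v
    refine aestronglyMeasurable_of_tendsto_ae atTop
      (f := fun (n : ℕ) z => ((n : ℝ) + 1) • (F (θ₀ + ((n : ℝ) + 1)⁻¹ • v) z - F θ₀ z)) ?_ ?_
    · intro n
      exact ((hF (θ₀ + ((n : ℝ) + 1)⁻¹ • v)).sub (hF θ₀)).const_smul ((n : ℝ) + 1)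
    · filter_upwards [hd] with z hz
      have hc : Tendsto (fun n : ℕ => ‖(n : ℝ) + 1‖) atTop atTop :=
        tendsto_norm_atTop_atTop.comp
          (tendsto_atTop_add_const_right _ _ tendsto_natCast_atTop_atTop)
      have h2 := hz.hasFDerivAt.lim v hc
      rwa [InnerProductSpace.toDual_apply_apply, real_inner_comm] at h2
  let b := EuclideanSpace.basisFun (Fin d) ℝ
  have : F' = fun z => ∑ i, (inner ℝ (b i) (F' z)) • b i := by
    funext z
    exact (b.sum_repr' _).symm
  rw [this]
  exact Finset.aestronglyMeasurable_fun_sum _ fun i _ => (key (b i)).smul_const _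

/-- Dominated differentiation for Fréchet derivatives, carried through the Riesz isomorphism; that
isomorphism commutes with the integral, as testing against vectors shows. -/
theorem hasGradientAt_integral {F : EuclideanSpace ℝ (Fin d) → Z → ℝ}
    {F' : EuclideanSpace ℝ (Fin d) → Z → EuclideanSpace ℝ (Fin d)}
    {θ₀ : EuclideanSpace ℝ (Fin d)} {ε : ℝ} (hε : 0 < ε) {G : Z → ℝ}
    (hF : ∀ θ, AEStronglyMeasurable (F θ) m) (hF0 : Integrable (F θ₀) m) (hG : Integrable G m)
    (hd : ∀ᵐ z ∂m, ∀ θ ∈ Metric.ball θ₀ ε, HasGradientAt (fun θ' => F θ' z) (F' θ z) θ ∧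
      ‖F' θ z‖ ≤ G z) :
    Integrable (F' θ₀) m ∧ HasGradientAt (fun θ => ∫ z, F θ z ∂m) (∫ z, F' θ₀ z ∂m) θ₀ := by
  have hm := aestronglyMeasurable_of_hasGradientAt (θ₀ := θ₀) hF
    (hd.mono fun z hz => (hz θ₀ (Metric.mem_ball_self hε)).1)
  have hi : Integrable (F' θ₀) m :=
    hG.mono' hm (hd.mono fun z hz => (hz θ₀ (Metric.mem_ball_self hε)).2)
  refine ⟨hi, ?_⟩
  have hm' : AEStronglyMeasurable (fun z => InnerProductSpace.toDual ℝ _ (F' θ₀ z)) m :=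
    (InnerProductSpace.toDual ℝ (EuclideanSpace ℝ (Fin d))).continuous.comp_aestronglyMeasurable hm
  have h := hasFDerivAt_integral_of_dominated_of_fderiv_le (𝕜 := ℝ) (μ := m) (F := F) (x₀ := θ₀)
    (F' := fun θ z => InnerProductSpace.toDual ℝ _ (F' θ z)) (bound := G)
    (Metric.ball_mem_nhds θ₀ hε) (Eventually.of_forall hF) hF0 hm'
    (hd.mono fun z hz θ hθ => by simpa using (hz θ hθ).2) hG
    (hd.mono fun z hz θ hθ => (hz θ hθ).1.hasFDerivAt)
  have hi' : Integrable (fun z => InnerProductSpace.toDual ℝ _ (F' θ₀ z)) m :=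
    hi.norm.mono' hm' (Eventually.of_forall fun z => by simp)
  have heq : InnerProductSpace.toDual ℝ _ (∫ z, F' θ₀ z ∂m) =
      ∫ z, InnerProductSpace.toDual ℝ _ (F' θ₀ z) ∂m := by
    refine ContinuousLinearMap.ext fun v => ?_
    rw [ContinuousLinearMap.integral_apply hi', InnerProductSpace.toDual_apply_apply,
      real_inner_comm, ← integral_inner hi]
    simp [real_inner_comm]
  rwa [hasGradientAt_iff_hasFDerivAt, heq]

end ParametricIntegral

/-! ### Score-function identities for the policy family -/

namespace Problem

variable {d N : ℕ} {𝒳 𝒴 : Type*} [MeasurableSpace 𝒳] [MeasurableSpace 𝒴]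
  (S : Problem d N 𝒳 𝒴)

/-- The product of the prompt distribution and the base measure. -/
noncomputable def ground : Measure (𝒳 × 𝒴) := S.prompts.prod S.base

/-- The gradient `∇_θ π_θ(y ∣ x)` of the density. -/
noncomputable def densGradient (θ : EuclideanSpace ℝ (Fin d)) (z : 𝒳 × 𝒴) :
    EuclideanSpace ℝ (Fin d) :=
  gradient (fun θ' => (S.policy θ').dens z.1 z.2) θ

theorem measurable_dens (p : Policy 𝒳 S.base) :
    Measurable fun z : 𝒳 × 𝒴 => p.dens z.1 z.2 :=
  p.measurable_dens

theorem measurable_cost' : Measurable fun z : 𝒳 × 𝒴 => S.cost z.1 z.2 :=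
  S.measurable_cost

theorem measurable_logRatio (θ : EuclideanSpace ℝ (Fin d)) : Measurable (S.logRatio θ) :=
  ((S.measurable_dens (S.policy θ)).div (S.measurable_dens S.ref)).log

theorem measurable_regReward (θ : EuclideanSpace ℝ (Fin d)) : Measurable (S.regReward θ) :=
  Measurable.sub S.measurable_reward ((S.measurable_logRatio θ).const_mul S.β)

theorem lintegral_dens (p : Policy 𝒳 S.base) :
    ∫⁻ z, ENNReal.ofReal (p.dens z.1 z.2) ∂S.ground = 1 := by
  have := S.prompts_prob
  have := S.base_sigmaFinite
  rw [ground, lintegral_prod _ (S.measurable_dens p).ennreal_ofReal.aemeasurable]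
  have h : ∀ x, ∫⁻ y, ENNReal.ofReal (p.dens x y) ∂S.base = 1 := by
    intro x
    have hi : Integrable (p.dens x) S.base := by
      -- A non-integrable density would have integral `0` by convention, not `1`.
      by_contra hn
      have h1 := p.integral_dens x
      rw [integral_undef hn] at h1
      exact zero_ne_one h1
    rw [← ofReal_integral_eq_lintegral_ofReal hi
      (Eventually.of_forall fun y => (p.dens_pos x y).le), p.integral_dens, ENNReal.ofReal_one]
  simp [h]

instance isProbabilityMeasure_joint (p : Policy 𝒳 S.base) :
    IsProbabilityMeasure (S.joint p) :=
  ⟨by rw [joint, withDensity_apply _ MeasurableSet.univ, Measure.restrict_univ]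
      exact S.lintegral_dens p⟩

instance isProbabilityMeasure_costLaw (p : Policy 𝒳 S.base) :
    IsProbabilityMeasure (S.costLaw p) :=
  Measure.isProbabilityMeasure_map S.measurable_cost'.aemeasurable

theorem integrable_dens (p : Policy 𝒳 S.base) :
    Integrable (fun z : 𝒳 × 𝒴 => p.dens z.1 z.2) S.ground := by
  refine ⟨(S.measurable_dens p).aestronglyMeasurable, ?_⟩
  rw [hasFiniteIntegral_iff_ofReal (Eventually.of_forall fun z : 𝒳 × 𝒴 =>
    (p.dens_pos z.1 z.2).le), S.lintegral_dens p]
  exact ENNReal.one_lt_top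

theorem integrable_joint_iff {E : Type*} [NormedAddCommGroup E] [NormedSpace ℝ E]
    (p : Policy 𝒳 S.base) (f : 𝒳 × 𝒴 → E) :
    Integrable f (S.joint p) ↔ Integrable (fun z => p.dens z.1 z.2 • f z) S.ground := by
  rw [joint, integrable_withDensity_iff_integrable_smul'
    (S.measurable_dens p).ennreal_ofReal (Eventually.of_forall fun z => ENNReal.ofReal_lt_top)]
  simp only [ENNReal.toReal_ofReal (p.dens_pos _ _).le]
  rfl

theorem integral_joint {E : Type*} [NormedAddCommGroup E] [NormedSpace ℝ E]
    (p : Policy 𝒳 S.base) (f : 𝒳 × 𝒴 → E) :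
    ∫ z, f z ∂(S.joint p) = ∫ z, p.dens z.1 z.2 • f z ∂S.ground := by
  rw [joint, integral_withDensity_eq_integral_toReal_smul
    (S.measurable_dens p).ennreal_ofReal (Eventually.of_forall fun z => ENNReal.ofReal_lt_top)]
  simp only [ENNReal.toReal_ofReal (p.dens_pos _ _).le]
  rfl

theorem measureReal_joint (p : Policy 𝒳 S.base) {A : Set (𝒳 × 𝒴)} (hA : MeasurableSet A) :
    (S.joint p).real A = ∫ z in A, p.dens z.1 z.2 ∂S.ground := by
  rw [← integral_indicator_one hA, S.integral_joint p, ← integral_indicator hA]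
  refine integral_congr_ae (Eventually.of_forall fun z => ?_)
  by_cases hz : z ∈ A <;> simp [hz]

theorem cdf_costLaw (p : Policy 𝒳 S.base) (t : ℝ) :
    cdf (S.costLaw p) t = ∫ z in {z | S.cost z.1 z.2 ≤ t}, p.dens z.1 z.2 ∂S.ground := by
  rw [cdf_eq_real, costLaw, map_measureReal_apply S.measurable_cost' measurableSet_Iic]
  exact S.measureReal_joint p (measurableSet_le S.measurable_cost' measurable_const)

theorem ground_absolutelyContinuous_joint (p : Policy 𝒳 S.base) : S.ground ≪ S.joint p :=
  withDensity_absolutelyContinuous' (S.measurable_dens p).ennreal_ofReal.aemeasurable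
    (Eventually.of_forall fun z => by
      simpa using p.dens_pos z.1 z.2)

variable {S} {θ₀ : EuclideanSpace ℝ (Fin d)}

theorem RegularAt.hasGradientAt_dens (h : S.RegularAt θ₀) :
    ∃ ε > 0, ∃ G : 𝒳 × 𝒴 → ℝ, Integrable G S.ground ∧
      ∀ᵐ z ∂S.ground, ∀ θ ∈ Metric.ball θ₀ ε,
        HasGradientAt (fun θ' => (S.policy θ').dens z.1 z.2) (S.densGradient θ z) θ ∧
        ‖S.densGradient θ z‖ * (1 + |S.reward z.1 z.2| + |S.logRatio θ z|) ≤ G z := by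
  obtain ⟨ε, hε, G, hG, hd⟩ := h.dominated
  exact ⟨ε, hε, G, hG, hd.mono fun z hz θ hθ =>
    ⟨(hz θ hθ).1.hasGradientAt, (hz θ hθ).2⟩⟩

/-- The envelope also controls `‖∇π‖` alone, its second factor being at least `1`. The whole space
gives conservation of mass, and sublevel sets of the cost give the distribution function. -/
theorem RegularAt.hasGradientAt_setIntegral_dens (h : S.RegularAt θ₀) (A : Set (𝒳 × 𝒴)) :
    HasGradientAt (fun θ => ∫ z in A, (S.policy θ).dens z.1 z.2 ∂S.ground)
      (∫ z in A, S.densGradient θ₀ z ∂S.ground) θ₀ := by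
  obtain ⟨ε, hε, G, hG, hd⟩ := h.hasGradientAt_dens
  refine (hasGradientAt_integral (m := S.ground.restrict A) (F' := S.densGradient) hε
    (fun θ => (S.measurable_dens (S.policy θ)).aestronglyMeasurable)
    (S.integrable_dens _).restrict hG.restrict (ae_restrict_of_ae ?_)).2
  filter_upwards [hd] with z hz θ hθ
  refine ⟨(hz θ hθ).1, le_trans ?_ (hz θ hθ).2⟩
  exact le_mul_of_one_le_right (norm_nonneg _)
    (by linarith [abs_nonneg (S.reward z.1 z.2), abs_nonneg (S.logRatio θ z)])

theorem RegularAt.integral_densGradient (h : S.RegularAt θ₀) :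
    ∫ z, S.densGradient θ₀ z ∂S.ground = 0 := by
  have h1 := h.hasGradientAt_setIntegral_dens Set.univ
  have h2 : (fun θ => ∫ z in Set.univ, (S.policy θ).dens z.1 z.2 ∂S.ground) = fun _ => 1 := by
    funext θ
    rw [← S.measureReal_joint _ MeasurableSet.univ, probReal_univ]
  rw [h2, Measure.restrict_univ] at h1
  exact h1.unique (hasGradientAt_const _ _)

theorem RegularAt.hasGradientAt_cdf (h : S.RegularAt θ₀) (t : ℝ) :
    HasGradientAt (fun θ => cdf (S.costLaw (S.policy θ)) t)
      (∫ z in {z | S.cost z.1 z.2 ≤ t}, S.densGradient θ₀ z ∂S.ground) θ₀ := by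
  simp_rw [S.cdf_costLaw]
  exact h.hasGradientAt_setIntegral_dens _

theorem RegularAt.aestronglyMeasurable_densGradient (h : S.RegularAt θ₀) :
    AEStronglyMeasurable (S.densGradient θ₀) S.ground := by
  obtain ⟨ε, hε, G, hG, hd⟩ := h.hasGradientAt_dens
  exact aestronglyMeasurable_of_hasGradientAt
    (fun θ => (S.measurable_dens (S.policy θ)).aestronglyMeasurable)
    (hd.mono fun z hz => (hz θ₀ (Metric.mem_ball_self hε)).1)

theorem RegularAt.integrable_densGradient (h : S.RegularAt θ₀) :
    Integrable (S.densGradient θ₀) S.ground := by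
  obtain ⟨ε, hε, G, hG, hd⟩ := h.hasGradientAt_dens
  refine hG.mono' h.aestronglyMeasurable_densGradient ?_
  filter_upwards [hd] with z hz
  refine le_trans ?_ (hz θ₀ (Metric.mem_ball_self hε)).2
  exact le_mul_of_one_le_right (norm_nonneg _)
    (by linarith [abs_nonneg (S.reward z.1 z.2), abs_nonneg (S.logRatio θ₀ z)])

/-- The summand `|β|` pays for the term `-β ∇π` that appears when the log-ratio is differentiated.
-/
theorem abs_regReward_le (θ : EuclideanSpace ℝ (Fin d)) (z : 𝒳 × 𝒴) :
    |S.regReward θ z| + |S.β| ≤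
      (1 + |S.β|) * (1 + |S.reward z.1 z.2| + |S.logRatio θ z|) := by
  have h1 : |S.regReward θ z| ≤ |S.reward z.1 z.2| + |S.β| * |S.logRatio θ z| := by
    rw [← abs_mul]; exact abs_sub _ _
  nlinarith [abs_nonneg (S.reward z.1 z.2), abs_nonneg (S.logRatio θ z), abs_nonneg S.β,
    mul_nonneg (abs_nonneg S.β) (abs_nonneg (S.reward z.1 z.2))]

theorem RegularAt.integrable_regReward_smul (h : S.RegularAt θ₀) :
    Integrable (fun z => S.regReward θ₀ z • S.densGradient θ₀ z) S.ground := by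
  obtain ⟨ε, hε, G, hG, hd⟩ := h.hasGradientAt_dens
  refine (hG.const_mul (1 + |S.β|)).mono' ((S.measurable_regReward θ₀).aestronglyMeasurable.smul
    h.aestronglyMeasurable_densGradient) ?_
  filter_upwards [hd] with z hz
  have h1 := (hz θ₀ (Metric.mem_ball_self hε)).2
  have h2 := S.abs_regReward_le θ₀ z
  have h3 := norm_nonneg (S.densGradient θ₀ z)
  rw [norm_smul, Real.norm_eq_abs]
  calc |S.regReward θ₀ z| * ‖S.densGradient θ₀ z‖
      ≤ ((1 + |S.β|) * (1 + |S.reward z.1 z.2| + |S.logRatio θ₀ z|)) * ‖S.densGradient θ₀ z‖ :=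
        mul_le_mul_of_nonneg_right (by linarith [abs_nonneg S.β]) h3
    _ = (1 + |S.β|) * (‖S.densGradient θ₀ z‖ *
          (1 + |S.reward z.1 z.2| + |S.logRatio θ₀ z|)) := by ring
    _ ≤ _ := mul_le_mul_of_nonneg_left h1 (by positivity)

/-- By the product rule the integrand has gradient `r̃ ∇π - β ∇π`, and the second term integrates to
zero. -/
theorem RegularAt.hasGradientAt_expectedReward (h : S.RegularAt θ₀) :
    HasGradientAt S.expectedReward
      (∫ z, S.regReward θ₀ z • S.densGradient θ₀ z ∂S.ground) θ₀ := by
  obtain ⟨ε, hε, G, hG, hd⟩ := h.hasGradientAt_dens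
  have hi0 : Integrable (S.regReward θ₀) (S.joint (S.policy θ₀)) :=
    h.integrable_reward.sub (h.integrable_logRatio.const_mul S.β)
  have key := hasGradientAt_integral (m := S.ground) (θ₀ := θ₀) (G := fun z => (1 + |S.β|) * G z)
    (F := fun θ z => (S.policy θ).dens z.1 z.2 • S.regReward θ z)
    (F' := fun θ z => S.regReward θ z • S.densGradient θ z - S.β • S.densGradient θ z) hε
    (fun θ => ((S.measurable_dens (S.policy θ)).smul
      (S.measurable_regReward θ)).aestronglyMeasurable)
    ((S.integrable_joint_iff _ _).1 hi0) (hG.const_mul _) ?_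
  · have h2 := key.2
    have h3 : Integrable (fun z => S.β • S.densGradient θ₀ z) S.ground :=
      h.integrable_densGradient.smul S.β
    rw [integral_sub h.integrable_regReward_smul h3, integral_smul, h.integral_densGradient, smul_zero, sub_zero] at h2
    refine h2.congr_of_eventuallyEq (Eventually.of_forall fun θ => ?_)
    exact S.integral_joint _ _
  · filter_upwards [hd] with z hz θ hθ
    obtain ⟨h1, h2⟩ := hz θ hθ
    constructor
    · have hp := (S.policy θ).dens_pos z.1 z.2
      have hr := S.ref.dens_pos z.1 z.2
      have hl : HasFDerivAt (fun θ' => S.regReward θ' z)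
          (-(S.β • ((S.policy θ).dens z.1 z.2)⁻¹ •
            InnerProductSpace.toDual ℝ _ (S.densGradient θ z))) θ := by
        have e : (fun θ' => S.regReward θ' z) = fun θ' => S.reward z.1 z.2 -
            S.β * (Real.log ((S.policy θ').dens z.1 z.2) - Real.log (S.ref.dens z.1 z.2)) := by
          funext θ'
          rw [regReward, logRatio, Real.log_div ((S.policy θ').dens_pos z.1 z.2).ne' hr.ne']
        rw [e]
        have := (((h1.hasFDerivAt.log hp.ne').sub_const
          (Real.log (S.ref.dens z.1 z.2))).const_mul S.β).const_sub (S.reward z.1 z.2)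
        exact this
      rw [hasGradientAt_iff_hasFDerivAt]
      refine (h1.hasFDerivAt.mul hl).congr_fderiv ?_
      ext v
      simp
      field_simp
      ring
    · have h3 := S.abs_regReward_le θ z
      have h4 := norm_nonneg (S.densGradient θ z)
      calc ‖S.regReward θ z • S.densGradient θ z - S.β • S.densGradient θ z‖
          ≤ |S.regReward θ z| * ‖S.densGradient θ z‖ + |S.β| * ‖S.densGradient θ z‖ := by
            refine (norm_sub_le _ _).trans ?_
            rw [norm_smul, norm_smul, Real.norm_eq_abs, Real.norm_eq_abs]
        _ = (|S.regReward θ z| + |S.β|) * ‖S.densGradient θ z‖ := by ring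
        _ ≤ ((1 + |S.β|) * (1 + |S.reward z.1 z.2| + |S.logRatio θ z|)) *
              ‖S.densGradient θ z‖ := mul_le_mul_of_nonneg_right h3 h4
        _ = (1 + |S.β|) * (‖S.densGradient θ z‖ *
              (1 + |S.reward z.1 z.2| + |S.logRatio θ z|)) := by ring
        _ ≤ _ := mul_le_mul_of_nonneg_left h2 (by positivity)

theorem RegularAt.dens_smul_score (h : S.RegularAt θ₀) :
    ∀ᵐ z ∂S.ground, (S.policy θ₀).dens z.1 z.2 • S.score θ₀ z = S.densGradient θ₀ z := by
  obtain ⟨ε, hε, G, hG, hd⟩ := h.hasGradientAt_dens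
  filter_upwards [hd] with z hz
  have h1 := (hz θ₀ (Metric.mem_ball_self hε)).1
  have hp := (S.policy θ₀).dens_pos z.1 z.2
  have h2 : HasGradientAt (fun θ' => Real.log ((S.policy θ').dens z.1 z.2))
      (((S.policy θ₀).dens z.1 z.2)⁻¹ • S.densGradient θ₀ z) θ₀ := by
    rw [hasGradientAt_iff_hasFDerivAt]
    refine (h1.hasFDerivAt.log hp.ne').congr_fderiv ?_
    ext v
    simp
  rw [score, h2.gradient, smul_inv_smul₀ hp.ne']

theorem RegularAt.dens_smul_estimatorIntegrand (h : S.RegularAt θ₀) (lam : ℝ) (g : Fin N → ℝ) :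
    (fun z => (S.policy θ₀).dens z.1 z.2 • S.estimatorIntegrand lam g θ₀ z) =ᵐ[S.ground]
      fun z => S.regReward θ₀ z • S.densGradient θ₀ z + lam • ∑ i, (-g i) •
        {z : 𝒳 × 𝒴 | S.cost z.1 z.2 ≤ S.particles (S.policy θ₀) i}.indicator
          (S.densGradient θ₀) z := by
  filter_upwards [h.dens_smul_score] with z hz
  rw [estimatorIntegrand, smul_comm, hz, add_smul, mul_smul, Finset.sum_smul]
  congr 2
  refine Finset.sum_congr rfl fun i _ => ?_
  by_cases hc : S.cost z.1 z.2 ≤ S.particles (S.policy θ₀) i <;> simp [hc]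

theorem RegularAt.integrable_indicator (h : S.RegularAt θ₀) (t : ℝ) :
    Integrable ({z : 𝒳 × 𝒴 | S.cost z.1 z.2 ≤ t}.indicator (S.densGradient θ₀)) S.ground :=
  h.integrable_densGradient.indicator (measurableSet_le S.measurable_cost' measurable_const)

theorem RegularAt.integrable_estimatorIntegrand (h : S.RegularAt θ₀) (lam : ℝ) (g : Fin N → ℝ) :
    Integrable (S.estimatorIntegrand lam g θ₀) (S.joint (S.policy θ₀)) := by
  rw [S.integrable_joint_iff]
  refine Integrable.congr ?_ (h.dens_smul_estimatorIntegrand lam g).symm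
  exact h.integrable_regReward_smul.add ((integrable_finsetSum _ fun i _ =>
    (h.integrable_indicator _).smul (-g i)).smul lam)

/-- The log-derivative identity turns the expectation into integrals of `∇π`, matching the two
gradients term by term. As `g` is arbitrary, this serves the unweighted, weighted and
density-corrected particle gradients alike. -/
theorem RegularAt.densityFreeGradient_eq_estimator (h : S.RegularAt θ₀) (lam : ℝ)
    (g : Fin N → ℝ) : S.densityFreeGradient lam g θ₀ = S.estimator lam g θ₀ := by
  have h1 : ∀ i, Integrable (fun z => (-g i) •
      {z : 𝒳 × 𝒴 | S.cost z.1 z.2 ≤ S.particles (S.policy θ₀) i}.indicator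
        (S.densGradient θ₀) z) S.ground := fun i => (h.integrable_indicator _).smul (-g i)
  have h2 : Integrable (fun z => lam • ∑ i, (-g i) •
      {z : 𝒳 × 𝒴 | S.cost z.1 z.2 ≤ S.particles (S.policy θ₀) i}.indicator
        (S.densGradient θ₀) z) S.ground := (integrable_finsetSum _ fun i _ => h1 i).smul lam
  rw [estimator, S.integral_joint, integral_congr_ae (h.dens_smul_estimatorIntegrand lam g),
    integral_add h.integrable_regReward_smul h2, integral_smul,
    integral_finsetSum _ fun i _ => h1 i, densityFreeGradient,
    h.hasGradientAt_expectedReward.gradient]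
  congr 2
  refine Finset.sum_congr rfl fun i _ => ?_
  rw [integral_smul, integral_indicator (measurableSet_le S.measurable_cost' measurable_const),
    cdfGradient, (h.hasGradientAt_cdf _).gradient, smul_neg, neg_smul]

end Problem

/-! ### Quantiles and derivatives of generalised inverses -/

section Quantile

variable {μ : Measure ℝ} {a : ℝ}

/-- Right-continuity makes the infimum attained; a level strictly between `0` and `1` makes the set
nonempty and bounded below. -/
theorem quantile_le_iff (ha : a ∈ Set.Ioo (0 : ℝ) 1) (t : ℝ) :
    quantile μ a ≤ t ↔ a ≤ cdf μ t := by
  obtain ⟨s, hs⟩ := ((tendsto_cdf_atBot μ).eventually (gt_mem_nhds ha.1)).exists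
  obtain ⟨r, hr⟩ := ((tendsto_cdf_atTop μ).eventually (lt_mem_nhds ha.2)).exists
  have hbdd : BddBelow {t : ℝ | a ≤ cdf μ t} := by
    refine ⟨s, fun x hx => ?_⟩
    by_contra hlt
    exact absurd ((monotone_cdf μ) (not_le.1 hlt).le) (not_le.2 (hs.trans_le hx))
  have hne : {t : ℝ | a ≤ cdf μ t}.Nonempty := ⟨r, hr.le⟩
  refine ⟨fun h => ?_, fun h => csInf_le hbdd h⟩
  have hq : a ≤ cdf μ (quantile μ a) := by
    have hc : Tendsto (cdf μ) (𝓝[>] (quantile μ a)) (𝓝 (cdf μ (quantile μ a))) :=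
      ((cdf μ).right_continuous _).mono_left (nhdsWithin_mono _ Set.Ioi_subset_Ici_self)
    refine ge_of_tendsto hc ?_
    filter_upwards [self_mem_nhdsWithin] with x hx
    obtain ⟨y, hy, hyx⟩ := exists_lt_of_csInf_lt hne hx
    exact le_trans hy (monotone_cdf μ hyx.le)
  exact hq.trans (monotone_cdf μ h)

theorem cdf_quantile (ha : a ∈ Set.Ioo (0 : ℝ) 1) (hc : ContinuousAt (cdf μ) (quantile μ a)) :
    cdf μ (quantile μ a) = a := by
  refine le_antisymm ?_ ((quantile_le_iff ha _).1 le_rfl)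
  refine le_of_tendsto (hc.tendsto.mono_left (nhdsWithin_le_nhds (s := Set.Iio (quantile μ a)))) ?_
  filter_upwards [self_mem_nhdsWithin] with x hx
  by_contra h
  exact absurd ((quantile_le_iff ha x).2 (not_le.1 h).le) (not_le.2 hx)

theorem measure_singleton_of_continuousAt_cdf [IsProbabilityMeasure μ] {t : ℝ}
    (hc : ContinuousAt (cdf μ) t) : μ {t} = 0 := by
  have h := (cdf μ).measure_singleton t
  rw [measure_cdf, hc.continuousWithinAt.leftLim_eq, sub_self, ENNReal.ofReal_zero] at h
  exact h

end Quantile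

/-- Differentiability of a generalised inverse of a family of functions. -/
theorem hasFDerivAt_generalizedInverse {E : Type*} [NormedAddCommGroup E] [NormedSpace ℝ E]
    {H : E → ℝ → ℝ} {Q : E → ℝ} {α f : ℝ} {θ₀ : E} {L : E →L[ℝ] ℝ}
    (hQ : ∀ θ t, Q θ ≤ t ↔ α ≤ H θ t) (hα : H θ₀ (Q θ₀) = α) (hf : 0 < f)
    (hH : HasDerivAt (H θ₀) f (Q θ₀)) (hL : HasFDerivAt (fun θ => H θ (Q θ₀)) L θ₀)
    (hinc : ∀ η > 0, ∃ δ > 0, ∀ θ t, ‖θ - θ₀‖ < δ → |t - Q θ₀| < δ →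
      |H θ t - H θ₀ t - (H θ (Q θ₀) - H θ₀ (Q θ₀))| ≤ η * ‖θ - θ₀‖) :
    HasFDerivAt Q (-(f⁻¹ • L)) θ₀ := by
  rw [hasFDerivAt_iff_isLittleO, Asymptotics.isLittleO_iff]
  intro c hc
  -- `M ‖θ - θ₀‖` bounds the distance from `Q θ₀` to every test point used below. With `η = f c /
  -- 4`, three errors of size `η ‖θ - θ₀‖` stay below `f c ‖θ - θ₀‖`.
  set M : ℝ := f⁻¹ * ‖L‖ + c with hM
  have hMpos : 0 < M := by positivity
  set η : ℝ := f * c / 4 with hη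
  have hηpos : 0 < η := by positivity
  obtain ⟨δ, hδ, hinc⟩ := hinc η hηpos
  rw [hasDerivAt_iff_isLittleO, Asymptotics.isLittleO_iff] at hH
  obtain ⟨δ', hδ', hH⟩ := Metric.eventually_nhds_iff.1 (hH (div_pos hηpos hMpos))
  rw [hasFDerivAt_iff_isLittleO, Asymptotics.isLittleO_iff] at hL
  have hball : ∀ᶠ θ in 𝓝 θ₀, ‖θ - θ₀‖ < min (δ / (M + 1)) (δ' / (M + 1)) := by
    have : Metric.ball θ₀ (min (δ / (M + 1)) (δ' / (M + 1))) ∈ 𝓝 θ₀ :=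
      Metric.ball_mem_nhds _ (by positivity)
    filter_upwards [this] with θ hθ
    rwa [Metric.mem_ball, dist_eq_norm] at hθ
  filter_upwards [hL hηpos, hball] with θ h1 h2
  rcases eq_or_ne θ θ₀ with rfl | hne
  · simp
  have hΔ : 0 < ‖θ - θ₀‖ := norm_pos_iff.2 (sub_ne_zero.2 hne)
  have hb1 : ‖θ - θ₀‖ * (M + 1) < δ :=
    (lt_div_iff₀ (by positivity)).1 (h2.trans_le (min_le_left _ _))
  have hb2 : ‖θ - θ₀‖ * (M + 1) < δ' :=
    (lt_div_iff₀ (by positivity)).1 (h2.trans_le (min_le_right _ _))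
  have hθδ : ‖θ - θ₀‖ < δ := by nlinarith
  -- At offset `s` from the predicted quantile, `H θ` equals `α + f s` up to three errors: the
  -- expansion in `t`, the expansion in `θ`, and the mixed increment.
  have key : ∀ s : ℝ, |s| ≤ c * ‖θ - θ₀‖ →
      |H θ (Q θ₀ - f⁻¹ * L (θ - θ₀) + s) - α - f * s| ≤ 3 * (η * ‖θ - θ₀‖) := by
    intro s hs
    set t := Q θ₀ - f⁻¹ * L (θ - θ₀) + s with ht
    have htq : |t - Q θ₀| ≤ M * ‖θ - θ₀‖ := by
      have e : t - Q θ₀ = s - f⁻¹ * L (θ - θ₀) := by rw [ht]; ring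
      have h3 : |f⁻¹ * L (θ - θ₀)| ≤ f⁻¹ * (‖L‖ * ‖θ - θ₀‖) := by
        rw [abs_mul, abs_of_pos (inv_pos.2 hf)]
        exact mul_le_mul_of_nonneg_left (L.le_opNorm _) (inv_pos.2 hf).le
      rw [e]
      calc _ ≤ |s| + |f⁻¹ * L (θ - θ₀)| := abs_sub _ _
        _ ≤ c * ‖θ - θ₀‖ + f⁻¹ * (‖L‖ * ‖θ - θ₀‖) := add_le_add hs h3
        _ = _ := by rw [hM]; ring
    have h3 := hinc θ t hθδ (by nlinarith)
    have h4 := hH (y := t) (by rw [Real.dist_eq]; nlinarith)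
    have h5 : η / M * ‖t - Q θ₀‖ ≤ η * ‖θ - θ₀‖ := by
      rw [Real.norm_eq_abs]
      calc η / M * |t - Q θ₀| ≤ η / M * (M * ‖θ - θ₀‖) :=
            mul_le_mul_of_nonneg_left htq (by positivity)
        _ = _ := by field_simp
    have h4 := h4.trans h5
    rw [Real.norm_eq_abs, smul_eq_mul] at h4
    rw [Real.norm_eq_abs] at h1
    have e : f * s = f * (t - Q θ₀) + L (θ - θ₀) := by
      rw [ht]; field_simp; ring
    rw [e]
    rw [hα] at h1 h3 h4
    rw [abs_le] at *
    constructor <;> linarith [h1.1, h1.2, h3.1, h3.2, h4.1, h4.2, mul_comm (t - Q θ₀) f]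
  have hcΔ : 0 < c * ‖θ - θ₀‖ := by positivity
  have hgap : 3 * (η * ‖θ - θ₀‖) < f * (c * ‖θ - θ₀‖) := by
    rw [hη]; nlinarith [mul_pos hf hcΔ]
  -- At the two extreme offsets `H θ` lies on opposite sides of `α`, so `hQ` traps `Q θ` between
  -- them.
  have hup := key (c * ‖θ - θ₀‖) (abs_of_pos hcΔ).le
  have hlo := key (-(c * ‖θ - θ₀‖)) (by rw [abs_neg, abs_of_pos hcΔ])
  have hQup := (hQ θ _).2 (show α ≤ _ by linarith [(abs_le.1 hup).1])
  have hQlo : ¬ Q θ ≤ Q θ₀ - f⁻¹ * L (θ - θ₀) + -(c * ‖θ - θ₀‖) := fun h => by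
    have := (hQ θ _).1 h
    linarith [(abs_le.1 hlo).2]
  rw [Real.norm_eq_abs, abs_le]
  simp only [neg_apply, smul_apply, smul_eq_mul]
  constructor <;> linarith

/-! ### Gradient of the cost quantiles -/

namespace Problem

variable {d N : ℕ} {𝒳 𝒴 : Type*} [MeasurableSpace 𝒳] [MeasurableSpace 𝒴]
  {S : Problem d N 𝒳 𝒴} {θ₀ : EuclideanSpace ℝ (Fin d)}

theorem ground_cost_eq_zero {t : ℝ} (p : Policy 𝒳 S.base)
    (hc : ContinuousAt (cdf (S.costLaw p)) t) :
    S.ground {z | S.cost z.1 z.2 = t} = 0 := by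
  refine S.ground_absolutelyContinuous_joint p ?_
  have := measure_singleton_of_continuousAt_cdf hc
  rwa [costLaw, Measure.map_apply S.measurable_cost' (measurableSet_singleton t)] at this

theorem RegularAt.exists_lipschitz_dens (h : S.RegularAt θ₀) :
    ∃ ε > 0, ∃ G : 𝒳 × 𝒴 → ℝ, Integrable G S.ground ∧
      ∀ᵐ z ∂S.ground, 0 ≤ G z ∧ ∀ θ ∈ Metric.ball θ₀ ε,
        |(S.policy θ).dens z.1 z.2 - (S.policy θ₀).dens z.1 z.2| ≤ G z * ‖θ - θ₀‖ := by
  obtain ⟨ε, hε, G, hG, hd⟩ := h.hasGradientAt_dens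
  refine ⟨ε, hε, G, hG, hd.mono fun z hz => ?_⟩
  have hb : ∀ θ ∈ Metric.ball θ₀ ε, ‖S.densGradient θ z‖ ≤ G z := fun θ hθ =>
    le_trans (le_mul_of_one_le_right (norm_nonneg _)
      (by linarith [abs_nonneg (S.reward z.1 z.2), abs_nonneg (S.logRatio θ z)])) (hz θ hθ).2
  refine ⟨(norm_nonneg _).trans (hb θ₀ (Metric.mem_ball_self hε)), fun θ hθ => ?_⟩
  exact (convex_ball θ₀ ε).norm_image_sub_le_of_norm_hasFDerivWithin_le
    (f := fun θ' => (S.policy θ').dens z.1 z.2)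
    (f' := fun θ' => InnerProductSpace.toDual ℝ _ (S.densGradient θ' z))
    (fun θ' hθ' => (hz θ' hθ').1.hasFDerivAt.hasFDerivWithinAt)
    (fun θ' hθ' => by simpa using hb θ' hθ') (Metric.mem_ball_self hε) hθ

theorem cdf_costLaw_sub (p : Policy 𝒳 S.base) {s t : ℝ} (hst : s ≤ t) :
    cdf (S.costLaw p) t - cdf (S.costLaw p) s =
      ∫ z in {z | S.cost z.1 z.2 ∈ Set.Ioc s t}, p.dens z.1 z.2 ∂S.ground := by
  have hu : {z : 𝒳 × 𝒴 | S.cost z.1 z.2 ≤ t} =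
      {z | S.cost z.1 z.2 ≤ s} ∪ {z | S.cost z.1 z.2 ∈ Set.Ioc s t} := by
    ext z
    simp only [Set.mem_ofPred_eq, Set.mem_union, Set.mem_Ioc]
    constructor
    · intro hz
      rcases le_or_gt (S.cost z.1 z.2) s with h | h
      · exact Or.inl h
      · exact Or.inr ⟨h, hz⟩
    · rintro (hz | hz)
      · exact hz.trans hst
      · exact hz.2
  have hm' : MeasurableSet {z : 𝒳 × 𝒴 | S.cost z.1 z.2 ∈ Set.Ioc s t} :=
    S.measurable_cost' measurableSet_Ioc
  rw [S.cdf_costLaw, S.cdf_costLaw, hu, setIntegral_union ?_ hm' (S.integrable_dens p).integrableOn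
    (S.integrable_dens p).integrableOn, add_sub_cancel_left]
  rw [Set.disjoint_left]
  exact fun z hz hz' => absurd hz (not_le.2 hz'.1)

/-- The mixed increment is, up to sign, the integral of a difference of densities over the cost
strip between `s` and `t`, where the Lipschitz envelope applies. -/
theorem abs_cdf_increment_le {θ : EuclideanSpace ℝ (Fin d)} {G : 𝒳 × 𝒴 → ℝ}
    (hG : Integrable G S.ground)
    (hd : ∀ᵐ z ∂S.ground, 0 ≤ G z ∧
      |(S.policy θ).dens z.1 z.2 - (S.policy θ₀).dens z.1 z.2| ≤ G z * ‖θ - θ₀‖)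
    {s t r : ℝ} (hr : |t - s| ≤ r) :
    |cdf (S.costLaw (S.policy θ)) t - cdf (S.costLaw (S.policy θ₀)) t -
      (cdf (S.costLaw (S.policy θ)) s - cdf (S.costLaw (S.policy θ₀)) s)| ≤
      (∫ z in {z | |S.cost z.1 z.2 - s| ≤ r}, G z ∂S.ground) * ‖θ - θ₀‖ := by
  have main : ∀ a b : ℝ, a ≤ b → (∀ x ∈ Set.Ioc a b, |x - s| ≤ r) →
      |(cdf (S.costLaw (S.policy θ)) b - cdf (S.costLaw (S.policy θ)) a) -
        (cdf (S.costLaw (S.policy θ₀)) b - cdf (S.costLaw (S.policy θ₀)) a)| ≤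
      (∫ z in {z | |S.cost z.1 z.2 - s| ≤ r}, G z ∂S.ground) * ‖θ - θ₀‖ := by
    intro a b hab hsub
    rw [cdf_costLaw_sub _ hab, cdf_costLaw_sub _ hab,
      ← integral_sub (S.integrable_dens _).integrableOn (S.integrable_dens _).integrableOn,
      ← Real.norm_eq_abs, ← integral_mul_const]
    refine (norm_integral_le_of_norm_le (hG.mul_const _).integrableOn
      (ae_restrict_of_ae (hd.mono fun z hz => hz.2))).trans ?_
    refine setIntegral_mono_set (hG.mul_const _).integrableOn (ae_restrict_of_ae ?_)
      (Eventually.of_forall fun z hz => hsub _ hz)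
    exact hd.mono fun z hz => mul_nonneg hz.1 (norm_nonneg _)
  rcases le_total s t with hst | hst
  · convert main s t hst (fun x hx => ?_) using 2
    · ring
    · rw [abs_of_nonneg (sub_nonneg.2 hst)] at hr
      rw [abs_of_pos (sub_pos.2 hx.1)]
      linarith [hx.2]
  · rw [abs_sub_comm]
    convert main t s hst (fun x hx => ?_) using 2
    · ring
    · rw [abs_of_nonpos (sub_nonpos.2 hst)] at hr
      rw [abs_of_nonpos (sub_nonpos.2 hx.2)]
      linarith [hx.1]

/-- The strips around `s` shrink to the null set `{c = s}`, so the integral of the envelope over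
them tends to zero. -/
theorem RegularAt.cdf_increment (h : S.RegularAt θ₀) {s : ℝ}
    (hs : S.ground {z | S.cost z.1 z.2 = s} = 0) :
    ∀ η > 0, ∃ δ > 0, ∀ θ t, ‖θ - θ₀‖ < δ → |t - s| < δ →
      |cdf (S.costLaw (S.policy θ)) t - cdf (S.costLaw (S.policy θ₀)) t -
        (cdf (S.costLaw (S.policy θ)) s - cdf (S.costLaw (S.policy θ₀)) s)| ≤
        η * ‖θ - θ₀‖ := by
  intro η hη
  obtain ⟨ε, hε, G, hG, hd⟩ := h.exists_lipschitz_dens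
  have hlim := tendsto_setIntegral_of_antitone (μ := S.ground) (f := G)
    (s := fun n : ℕ => {z : 𝒳 × 𝒴 | |S.cost z.1 z.2 - s| ≤ 1 / ((n : ℝ) + 1)})
    (fun n => measurableSet_le (S.measurable_cost'.sub_const s).abs measurable_const)
    (fun a b hab z (hz : |S.cost z.1 z.2 - s| ≤ 1 / ((b : ℝ) + 1)) =>
      hz.trans (Nat.one_div_le_one_div hab)) ⟨0, hG.integrableOn⟩
  have hinter : (⋂ n : ℕ, {z : 𝒳 × 𝒴 | |S.cost z.1 z.2 - s| ≤ 1 / ((n : ℝ) + 1)}) =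
      {z | S.cost z.1 z.2 = s} := by
    ext z
    simp only [Set.mem_iInter, Set.mem_ofPred_eq]
    refine ⟨fun hz => ?_, fun hz n => by rw [hz]; simp; positivity⟩
    have := ge_of_tendsto' (tendsto_one_div_add_atTop_nhds_zero_nat (𝕜 := ℝ)) hz
    exact sub_eq_zero.1 (abs_nonpos_iff.1 this)
  rw [hinter, setIntegral_measure_zero _ hs] at hlim
  obtain ⟨n, hn⟩ := (hlim.eventually (gt_mem_nhds hη)).exists
  refine ⟨min ε (1 / ((n : ℝ) + 1)), lt_min hε (by positivity), fun θ t hθ ht => ?_⟩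
  have hθ' : θ ∈ Metric.ball θ₀ ε := by
    rw [Metric.mem_ball, dist_eq_norm]; exact hθ.trans_le (min_le_left _ _)
  refine (abs_cdf_increment_le hG (hd.mono fun z hz => ⟨hz.1, hz.2 θ hθ'⟩)
    (ht.le.trans (min_le_right _ _))).trans ?_
  exact mul_le_mul_of_nonneg_right hn.le (norm_nonneg _)

theorem RegularAt.hasGradientAt_particles (h : S.RegularAt θ₀) (i : Fin N) {f : ℝ} (hf : 0 < f)
    (hd : HasDerivAt (fun t => cdf (S.costLaw (S.policy θ₀)) t) f
      (S.particles (S.policy θ₀) i)) :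
    HasGradientAt (fun θ => S.particles (S.policy θ) i) (-(f⁻¹ • S.cdfGradient θ₀ i)) θ₀ := by
  have hc : ContinuousAt (cdf (S.costLaw (S.policy θ₀))) (S.particles (S.policy θ₀) i) :=
    hd.continuousAt
  have hg : HasGradientAt (fun θ => cdf (S.costLaw (S.policy θ)) (S.particles (S.policy θ₀) i))
      (S.cdfGradient θ₀ i) θ₀ := by
    rw [cdfGradient, (h.hasGradientAt_cdf _).gradient]
    exact h.hasGradientAt_cdf _
  have key := hasFDerivAt_generalizedInverse
    (H := fun θ t => cdf (S.costLaw (S.policy θ)) t) (Q := fun θ => S.particles (S.policy θ) i)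
    (fun θ t => quantile_le_iff (S.level_mem i) t) (cdf_quantile (S.level_mem i) hc) hf hd
    hg.hasFDerivAt (h.cdf_increment (ground_cost_eq_zero _ hc))
  rw [hasGradientAt_iff_hasFDerivAt]
  refine key.congr_fderiv ?_
  ext v
  simp

end Problem

/-! ### Strong convexity and the envelope theorem for entropic transport -/

section EntropicTransport

variable {N M : ℕ} {a : Fin N → ℝ} {b : Fin M → ℝ}

/-- The second derivative is `1/x - 1 ≥ 0`: on `[0,1]` the function `x log x` is strongly convex
with modulus one. -/
theorem convexOn_mul_log_sub_sq :
    ConvexOn ℝ (Set.Icc (0 : ℝ) 1) fun x => x * Real.log x - x ^ 2 / 2 := by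
  have hd : ∀ x ∈ interior (Set.Icc (0 : ℝ) 1),
      HasDerivAt (fun x => x * Real.log x - x ^ 2 / 2) (Real.log x + 1 - x) x := by
    intro x hx
    rw [interior_Icc] at hx
    exact ((Real.hasDerivAt_mul_log hx.1.ne').sub
      ((hasDerivAt_pow 2 x).div_const 2)).congr_deriv (by norm_num)
  have hd2 : ∀ x ∈ interior (Set.Icc (0 : ℝ) 1),
      HasDerivAt (fun x => Real.log x + 1 - x) (x⁻¹ - 1) x := by
    intro x hx
    rw [interior_Icc] at hx
    exact ((Real.hasDerivAt_log hx.1.ne').add_const 1).sub (hasDerivAt_id x)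
  refine convexOn_of_hasDerivWithinAt2_nonneg (convex_Icc 0 1) ?_
    (fun x hx => (hd x hx).hasDerivWithinAt) (fun x hx => (hd2 x hx).hasDerivWithinAt) ?_
  · exact (Real.continuous_mul_log.sub (by fun_prop)).continuousOn
  · intro x hx
    rw [interior_Icc] at hx
    exact sub_nonneg.2 ((one_le_inv₀ hx.1).2 hx.2.le)

theorem mul_log_midpoint_le {x y : ℝ} (hx : x ∈ Set.Icc (0 : ℝ) 1) (hy : y ∈ Set.Icc (0 : ℝ) 1) :
    ((x + y) / 2) * Real.log ((x + y) / 2) ≤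
      (x * Real.log x + y * Real.log y) / 2 - (x - y) ^ 2 / 8 := by
  have h := convexOn_mul_log_sub_sq.2 hx hy (by norm_num : (0 : ℝ) ≤ 1 / 2)
    (by norm_num : (0 : ℝ) ≤ 1 / 2) (by norm_num)
  simp only [smul_eq_mul] at h
  rw [show 1 / 2 * x + 1 / 2 * y = (x + y) / 2 by ring] at h
  nlinarith

/-- The regularised transport objective. -/
noncomputable def planObjective (χ : ℝ) (C P : Matrix (Fin N) (Fin M) ℝ) : ℝ :=
  (∑ i, ∑ j, P i j * C i j) - χ * planEntropy P

theorem mem_Icc_of_mem_couplings (ha : ∀ i, a i ≤ 1) {P : Matrix (Fin N) (Fin M) ℝ}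
    (hP : P ∈ couplings a b) (i : Fin N) (j : Fin M) : P i j ∈ Set.Icc (0 : ℝ) 1 := by
  refine ⟨hP.1 i j, le_trans ?_ (ha i)⟩
  rw [← hP.2.1 i]
  exact Finset.single_le_sum (f := fun j => P i j) (fun k _ => hP.1 i k) (Finset.mem_univ j)

theorem isCompact_couplings (ha : ∀ i, a i ≤ 1) : IsCompact (couplings a b) := by
  have hK : IsCompact (Set.pi Set.univ fun _ : Fin N => Set.pi Set.univ fun _ : Fin M =>
      Set.Icc (0 : ℝ) 1) := isCompact_univ_pi fun _ => isCompact_univ_pi fun _ => isCompact_Icc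
  have hc : IsClosed (couplings a b) := by
    have e : ∀ i j, Continuous fun P : Matrix (Fin N) (Fin M) ℝ => P i j :=
      fun i j => continuous_id.matrix_elem i j
    have h : couplings a b = (⋂ i, ⋂ j, {P | 0 ≤ P i j}) ∩
        ((⋂ i, {P | ∑ j, P i j = a i}) ∩ ⋂ j, {P | ∑ i, P i j = b j}) := by
      ext P
      simp [couplings]
    rw [h]
    exact (isClosed_iInter fun i => isClosed_iInter fun j =>
      isClosed_le continuous_const (e i j)).inter
      ((isClosed_iInter fun i => isClosed_eq
        (continuous_finsetSum _ fun j _ => e i j) continuous_const).inter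
      (isClosed_iInter fun j => isClosed_eq
        (continuous_finsetSum _ fun i _ => e i j) continuous_const))
  exact hK.of_isClosed_subset hc fun P hP i _ j _ => mem_Icc_of_mem_couplings ha hP i j

theorem continuous_planObjective (χ : ℝ) (C : Matrix (Fin N) (Fin M) ℝ) :
    Continuous (planObjective χ C) := by
  have e : ∀ i j, Continuous fun P : Matrix (Fin N) (Fin M) ℝ => P i j :=
    fun i j => continuous_id.matrix_elem i j
  have h1 : ∀ i j, Continuous fun P : Matrix (Fin N) (Fin M) ℝ => P i j * Real.log (P i j) :=
    fun i j => Real.continuous_mul_log.comp (e i j)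
  unfold planObjective planEntropy
  exact (continuous_finsetSum _ fun i _ => continuous_finsetSum _ fun j _ =>
    (e i j).mul continuous_const).sub (continuous_const.mul (continuous_finsetSum _ fun i _ =>
      continuous_finsetSum _ fun j _ => h1 i j).neg)

theorem exists_entropicOT_eq (ha : ∀ i, a i ≤ 1) (hne : (couplings a b).Nonempty) (χ : ℝ)
    (C : Matrix (Fin N) (Fin M) ℝ) :
    ∃ P ∈ couplings a b, entropicOT χ a b C = planObjective χ C P ∧
      ∀ Q ∈ couplings a b, planObjective χ C P ≤ planObjective χ C Q := by
  obtain ⟨P, hP, hmin⟩ := (isCompact_couplings ha).exists_isMinOn hne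
    (continuous_planObjective χ C).continuousOn
  refine ⟨P, hP, ?_, fun Q hQ => hmin hQ⟩
  exact IsLeast.csInf_eq ⟨⟨P, hP, rfl⟩, by rintro _ ⟨Q, hQ, rfl⟩; exact hmin hQ⟩

theorem planObjective_sub (χ : ℝ) (C C' P : Matrix (Fin N) (Fin M) ℝ) :
    planObjective χ C' P - planObjective χ C P = ∑ i, ∑ j, P i j * (C' i j - C i j) := by
  simp only [planObjective, mul_sub, Finset.sum_sub_distrib]
  ring

theorem midpoint_mem_couplings {P Q : Matrix (Fin N) (Fin M) ℝ} (hP : P ∈ couplings a b)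
    (hQ : Q ∈ couplings a b) : (Matrix.of fun i j => (P i j + Q i j) / 2) ∈ couplings a b := by
  refine ⟨fun i j => ?_, fun i => ?_, fun j => ?_⟩
  · have := hP.1 i j
    have := hQ.1 i j
    simp only [Matrix.of_apply]
    positivity
  · simp only [Matrix.of_apply, ← Finset.sum_div, Finset.sum_add_distrib, hP.2.1, hQ.2.1]
    ring
  · simp only [Matrix.of_apply, ← Finset.sum_div, Finset.sum_add_distrib, hP.2.2, hQ.2.2]
    ring

theorem planObjective_midpoint_le (ha : ∀ i, a i ≤ 1) {χ : ℝ} (hχ : 0 ≤ χ)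
    (C : Matrix (Fin N) (Fin M) ℝ) {P Q : Matrix (Fin N) (Fin M) ℝ} (hP : P ∈ couplings a b)
    (hQ : Q ∈ couplings a b) :
    planObjective χ C (Matrix.of fun i j => (P i j + Q i j) / 2) ≤
      (planObjective χ C P + planObjective χ C Q) / 2 -
        χ / 8 * ∑ i, ∑ j, (P i j - Q i j) ^ 2 := by
  have e : ∀ R : Matrix (Fin N) (Fin M) ℝ, planObjective χ C R =
      ∑ i, ∑ j, (R i j * C i j + χ * (R i j * Real.log (R i j))) := by
    intro R
    simp only [planObjective, planEntropy, Finset.sum_add_distrib, ← Finset.mul_sum]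
    ring
  rw [e, e, e, ← Finset.sum_add_distrib, Finset.sum_div, Finset.mul_sum, ← Finset.sum_sub_distrib]
  refine Finset.sum_le_sum fun i _ => ?_
  rw [← Finset.sum_add_distrib, Finset.sum_div, Finset.mul_sum, ← Finset.sum_sub_distrib]
  refine Finset.sum_le_sum fun j _ => ?_
  have h := mul_le_mul_of_nonneg_left (mul_log_midpoint_le (mem_Icc_of_mem_couplings ha hP i j)
    (mem_Icc_of_mem_couplings ha hQ i j)) hχ
  simp only [Matrix.of_apply]
  linarith

/-- The midpoint of `P` and `Q` is admissible, so it cannot beat the minimiser `P`; strong convexity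
at the midpoint then forces quadratic growth. -/
theorem planObjective_add_sq_le (ha : ∀ i, a i ≤ 1) {χ : ℝ} (hχ : 0 ≤ χ)
    {C P Q : Matrix (Fin N) (Fin M) ℝ} (hP : P ∈ couplings a b)
    (hmin : ∀ Q ∈ couplings a b, planObjective χ C P ≤ planObjective χ C Q)
    (hQ : Q ∈ couplings a b) :
    planObjective χ C P + χ / 4 * ∑ i, ∑ j, (P i j - Q i j) ^ 2 ≤ planObjective χ C Q := by
  have h1 := planObjective_midpoint_le ha hχ C hP hQ
  have h2 := hmin _ (midpoint_mem_couplings hP hQ)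
  linarith

/-- Quantitative envelope theorem: the regularised transport value is differentiable in the cost,
with derivative the optimal plan. -/
theorem abs_entropicOT_sub_le (ha : ∀ i, a i ≤ 1) (hne : (couplings a b).Nonempty) {χ : ℝ}
    (hχ : 0 < χ) {C P : Matrix (Fin N) (Fin M) ℝ} (hP : P ∈ couplings a b)
    (hmin : ∀ Q ∈ couplings a b, planObjective χ C P ≤ planObjective χ C Q)
    (C' : Matrix (Fin N) (Fin M) ℝ) :
    |entropicOT χ a b C' - planObjective χ C P - ∑ i, ∑ j, P i j * (C' i j - C i j)| ≤
      2 / χ * ∑ i, ∑ j, (C' i j - C i j) ^ 2 := by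
  obtain ⟨P', hP', hV, hmin'⟩ := exists_entropicOT_eq ha hne χ C'
  have h1 := planObjective_add_sq_le ha hχ.le hP hmin hP'
  have h2 := planObjective_add_sq_le ha hχ.le hP' hmin' hP
  have e1 := planObjective_sub χ C C' P
  have e2 := planObjective_sub χ C C' P'
  have hsq : ∑ i, ∑ j, (P' i j - P i j) ^ 2 = ∑ i, ∑ j, (P i j - P' i j) ^ 2 :=
    Finset.sum_congr rfl fun i _ => Finset.sum_congr rfl fun j _ => by ring
  -- Young's inequality, scaled so that the quadratic growth `h1` absorbs the distance between the
  -- plans; only the squared change of cost remains.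
  have hyoung : (∑ i, ∑ j, P i j * (C' i j - C i j)) - ∑ i, ∑ j, P' i j * (C' i j - C i j) ≤
      χ / 4 * ∑ i, ∑ j, (P i j - P' i j) ^ 2 + 1 / χ * ∑ i, ∑ j, (C' i j - C i j) ^ 2 := by
    rw [← Finset.sum_sub_distrib, Finset.mul_sum, Finset.mul_sum, ← Finset.sum_add_distrib]
    refine Finset.sum_le_sum fun i _ => ?_
    rw [← Finset.sum_sub_distrib, Finset.mul_sum, Finset.mul_sum, ← Finset.sum_add_distrib]
    refine Finset.sum_le_sum fun j _ => ?_
    have h3 : χ / 4 * (P i j - P' i j) ^ 2 + 1 / χ * (C' i j - C i j) ^ 2 -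
        (P i j * (C' i j - C i j) - P' i j * (C' i j - C i j)) =
        1 / χ * (χ / 2 * (P i j - P' i j) - (C' i j - C i j)) ^ 2 := by
      field_simp
      ring
    have h4 : 0 ≤ 1 / χ * (χ / 2 * (P i j - P' i j) - (C' i j - C i j)) ^ 2 := by positivity
    linarith
  rw [hsq] at h2
  have e3 : 2 / χ * ∑ i, ∑ j, (C' i j - C i j) ^ 2 =
      2 * (1 / χ * ∑ i, ∑ j, (C' i j - C i j) ^ 2) := by ring
  have h5 : 0 ≤ χ / 4 * ∑ i, ∑ j, (P i j - P' i j) ^ 2 := by positivity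
  rw [hV, e3, abs_le]
  constructor <;> linarith

/-- A crude bound suffices: what matters is that it does not depend on `χ`. -/
theorem planEntropy_mem_Icc (ha : ∀ i, a i ≤ 1) {P : Matrix (Fin N) (Fin M) ℝ}
    (hP : P ∈ couplings a b) : planEntropy P ∈ Set.Icc (0 : ℝ) (N * M) := by
  have h : ∀ i j, -(P i j * Real.log (P i j)) ∈ Set.Icc (0 : ℝ) 1 := by
    intro i j
    obtain ⟨h0, h1⟩ := mem_Icc_of_mem_couplings ha hP i j
    refine ⟨neg_nonneg.2 (mul_nonpos_of_nonneg_of_nonpos h0 (Real.log_nonpos h0 h1)), ?_⟩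
    rcases h0.eq_or_lt with h | h
    · simp [← h]
    · have h2 := Real.log_le_sub_one_of_pos (inv_pos.2 h)
      rw [Real.log_inv] at h2
      have h3 := mul_le_mul_of_nonneg_left h2 h0
      rw [mul_sub, mul_inv_cancel₀ h.ne'] at h3
      linarith
  have e : planEntropy P = ∑ i, ∑ j, -(P i j * Real.log (P i j)) := by
    simp only [planEntropy, Finset.sum_neg_distrib]
  rw [e]
  refine ⟨Finset.sum_nonneg fun i _ => Finset.sum_nonneg fun j _ => (h i j).1, ?_⟩
  calc _ ≤ ∑ _i : Fin N, ∑ _j : Fin M, (1 : ℝ) :=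
        Finset.sum_le_sum fun i _ => Finset.sum_le_sum fun j _ => (h i j).2
    _ = _ := by simp

end EntropicTransport

/-! ### Optimality of the monotone coupling -/

section MonotoneCoupling

variable {N : ℕ}

/-- For `x`, `y` sorted there is a nondecreasing 1-Lipschitz potential whose increment from `x i`
to `y i` is `(y i - x i)₊`. -/
theorem exists_potential {x y : Fin N → ℝ} (hx : Monotone x) (hy : Monotone y) :
    ∃ G : ℝ → ℝ, (∀ s t, G t - G s ≤ max (t - s) 0) ∧
      ∀ i, G (y i) - G (x i) = max (y i - x i) 0 := by
  set U : Set ℝ := ⋃ i, Set.Ico (x i) (y i) with hU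
  have hUm : MeasurableSet U := MeasurableSet.iUnion fun i => measurableSet_Ico
  have hUfin : volume U ≠ ⊤ := by
    refine ((measure_iUnion_fintype_le volume _).trans_lt ?_).ne
    exact ENNReal.sum_lt_top.2 fun i _ => by simp
  have hfin : ∀ t : ℝ, volume (Set.Iio t ∩ U) ≠ ⊤ := fun t =>
    measure_ne_top_of_subset Set.inter_subset_right hUfin
  have hdiff : ∀ s t : ℝ, s ≤ t → volume.real (Set.Iio t ∩ U) - volume.real (Set.Iio s ∩ U) =
      volume.real (Set.Ico s t ∩ U) := by
    intro s t hst
    have e : Set.Iio t ∩ U = (Set.Iio s ∩ U) ∪ (Set.Ico s t ∩ U) := by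
      rw [← Set.union_inter_distrib_right, Set.Iio_union_Ico_eq_Iio hst]
    rw [e, measureReal_union ?_ (measurableSet_Ico.inter hUm) (hfin s)
      (measure_ne_top_of_subset Set.inter_subset_right hUfin)]
    · ring
    · rw [Set.disjoint_left]
      exact fun z hz hz' => absurd hz.1 (not_lt.2 hz'.1.1)
  refine ⟨fun t => volume.real (Set.Iio t ∩ U), fun s t => ?_, fun i => ?_⟩
  · rcases le_total s t with h | h
    · refine le_trans ?_ (le_max_left _ _)
      simp only
      rw [hdiff s t h]
      refine (measureReal_mono Set.inter_subset_left (by simp)).trans ?_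
      rw [Real.volume_real_Ico_of_le h]
    · refine le_trans ?_ (le_max_right _ _)
      exact sub_nonpos.2 (measureReal_mono
        (Set.inter_subset_inter_left _ (Set.Iio_subset_Iio h)) (hfin s))
  · simp only
    rcases le_total (x i) (y i) with h | h
    · rw [hdiff _ _ h, Set.inter_eq_left.2 (Set.subset_iUnion (fun i => Set.Ico (x i) (y i)) i),
        Real.volume_real_Ico_of_le h, max_eq_left (sub_nonneg.2 h)]
    · have he : Set.Ico (y i) (x i) ∩ U = ∅ := by
        rw [Set.eq_empty_iff_forall_notMem]
        rintro z ⟨hz, hzU⟩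
        obtain ⟨j, hj⟩ := Set.mem_iUnion.1 hzU
        rcases le_total i j with hij | hij
        · exact absurd (hx hij) (not_le.2 (hj.1.trans_lt hz.2))
        · exact absurd (hy hij) (not_le.2 (hz.1.trans_lt hj.2))
      rw [← neg_sub, hdiff _ _ h, he, measureReal_empty, neg_zero, max_eq_right (sub_nonpos.2 h)]

/-- Optimality of the monotone coupling for the cost `(y - x)₊`. -/
theorem sum_diag_le_of_mem_couplings {x y : Fin N → ℝ} (hx : Monotone x) (hy : Monotone y) {c : ℝ}
    {P : Matrix (Fin N) (Fin N) ℝ} (hP : P ∈ couplings (fun _ => c) fun _ => c) :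
    ∑ i, c * max (y i - x i) 0 ≤ ∑ i, ∑ j, P i j * max (y j - x i) 0 := by
  -- `G` is a dual certificate: its total increment depends only on the marginals and is tight on
  -- the diagonal.
  obtain ⟨G, hG, hGd⟩ := exists_potential hx hy
  calc ∑ i, c * max (y i - x i) 0 = ∑ j, c * G (y j) - ∑ i, c * G (x i) := by
        simp only [← hGd, mul_sub, Finset.sum_sub_distrib]
    _ = ∑ j, ∑ i, P i j * G (y j) - ∑ i, ∑ j, P i j * G (x i) := by
        simp only [← Finset.sum_mul, hP.2.1, hP.2.2]
    _ = ∑ i, ∑ j, P i j * (G (y j) - G (x i)) := by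
        rw [Finset.sum_comm]
        simp only [mul_sub, Finset.sum_sub_distrib]
    _ ≤ _ := Finset.sum_le_sum fun i _ => Finset.sum_le_sum fun j _ =>
        mul_le_mul_of_nonneg_left (hG _ _) (hP.1 i j)

theorem diagonal_mem_couplings {c : ℝ} (hc : 0 ≤ c) :
    Matrix.diagonal (fun _ : Fin N => c) ∈ couplings (fun _ => c) fun _ => c := by
  refine ⟨fun i j => ?_, fun i => ?_, fun j => ?_⟩
  · rw [Matrix.diagonal_apply]; split_ifs <;> [exact hc; exact le_rfl]
  · simp [Matrix.diagonal_apply]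
  · simp [Matrix.diagonal_apply]

end MonotoneCoupling

/-! ### Particle derivatives of the entropic objective and their limit -/

section EntropicParticles

variable {N : ℕ} {q q' : Fin N → ℝ}

/-- Since `q i ≠ q' j`, small moves of the particles never cross the kink of the positive part. -/
theorem eventually_cost_affine (hne : ∀ i j, q i ≠ q' j) :
    ∀ᶠ p in 𝓝 q, ∀ i j, max (q' j - p i) 0 =
      max (q' j - q i) 0 - (p i - q i) * (if q i < q' j then (1 : ℝ) else 0) := by
  rw [eventually_all]; intro i
  rw [eventually_all]; intro j
  have hc : Tendsto (fun p : Fin N → ℝ => p i) (𝓝 q) (𝓝 (q i)) := (continuous_apply i).tendsto q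
  rcases lt_or_gt_of_ne (hne i j) with h | h
  · filter_upwards [hc.eventually (gt_mem_nhds h)] with p hp
    rw [if_pos h, max_eq_left (by linarith), max_eq_left (by linarith)]
    ring
  · filter_upwards [hc.eventually (lt_mem_nhds h)] with p hp
    rw [if_neg h.not_gt, max_eq_right (by linarith), max_eq_right (by linarith)]
    ring

theorem particleDeriv_eq {Φ : (Fin N → ℝ) → ℝ} {L : (Fin N → ℝ) →L[ℝ] ℝ}
    (h : HasFDerivAt Φ L q) (i : Fin N) : particleDeriv Φ q i = L (Pi.single i 1) := by
  have h1 : HasFDerivAt Φ L (Function.update q i (q i)) := by rwa [Function.update_eq_self]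
  exact (h1.comp_hasDerivAt (q i) (hasDerivAt_update q i (q i))).deriv

theorem inv_natCast_le_one (i : Fin N) : (N : ℝ)⁻¹ ≤ 1 :=
  inv_le_one_of_one_le₀ (by exact_mod_cast (Nat.zero_lt_of_lt i.isLt))

theorem uniformCouplings_nonempty :
    (couplings (fun _ : Fin N => (N : ℝ)⁻¹) fun _ : Fin N => (N : ℝ)⁻¹).Nonempty :=
  ⟨_, diagonal_mem_couplings (by positivity)⟩

/-- The envelope bound leaves a remainder quadratic in the change of cost, hence quadratic in `p -
q`. -/
theorem hasFDerivAt_entropicFSD (hne : ∀ i j, q i ≠ q' j) {χ : ℝ} (hχ : 0 < χ)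
    {P : Matrix (Fin N) (Fin N) ℝ}
    (hP : P ∈ couplings (fun _ : Fin N => (N : ℝ)⁻¹) fun _ : Fin N => (N : ℝ)⁻¹)
    (hmin : ∀ Q ∈ couplings (fun _ : Fin N => (N : ℝ)⁻¹) fun _ : Fin N => (N : ℝ)⁻¹,
      planObjective χ (Matrix.of fun i j => max (q' j - q i) 0) P ≤
        planObjective χ (Matrix.of fun i j => max (q' j - q i) 0) Q) :
    HasFDerivAt (fun p => entropicFSD χ p q')
      (-∑ i, (∑ j, P i j * (if q i < q' j then (1 : ℝ) else 0)) •
        ContinuousLinearMap.proj (R := ℝ) (φ := fun _ : Fin N => ℝ) i) q := by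
  set L : (Fin N → ℝ) →L[ℝ] ℝ := -∑ i, (∑ j, P i j * (if q i < q' j then (1 : ℝ) else 0)) •
    ContinuousLinearMap.proj (R := ℝ) (φ := fun _ : Fin N => ℝ) i with hL
  set V := planObjective χ (Matrix.of fun i j => max (q' j - q i) 0) P with hV
  have hO : (fun p => entropicFSD χ p q' - V - L (p - q)) =O[𝓝 q] fun p => ‖p - q‖ ^ 2 := by
    refine Asymptotics.IsBigO.of_bound (2 / χ * (N * N)) ?_
    filter_upwards [eventually_cost_affine hne] with p hp
    have h := abs_entropicOT_sub_le (fun i => inv_natCast_le_one i) uniformCouplings_nonempty hχ hP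
      hmin (Matrix.of fun i j => max (q' j - p i) 0)
    simp only [Matrix.of_apply] at h
    have e1 : ∑ i, ∑ j, P i j * (max (q' j - p i) 0 - max (q' j - q i) 0) = L (p - q) := by
      simp only [hL, hp, neg_apply, sum_apply, smul_apply, ContinuousLinearMap.proj_apply,
        Pi.sub_apply, smul_eq_mul, Finset.sum_mul]
      rw [← Finset.sum_neg_distrib]
      refine Finset.sum_congr rfl fun i _ => ?_
      rw [← Finset.sum_neg_distrib]
      exact Finset.sum_congr rfl fun j _ => by ring
    have e2 : ∑ i, ∑ j, (max (q' j - p i) 0 - max (q' j - q i) 0) ^ 2 ≤ N * N * ‖p - q‖ ^ 2 := by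
      calc _ ≤ ∑ _i : Fin N, ∑ _j : Fin N, ‖p - q‖ ^ 2 := by
            refine Finset.sum_le_sum fun i _ => Finset.sum_le_sum fun j _ => ?_
            refine sq_le_sq' ?_ ?_ <;>
            · have h1 := abs_le.1 ((norm_le_pi_norm (p - q) i))
              rw [Pi.sub_apply] at h1
              rw [hp i j]
              split_ifs <;> linarith [norm_nonneg (p - q), h1.1, h1.2]
        _ = _ := by simp; ring
    rw [e1] at h
    rw [Real.norm_eq_abs, Real.norm_eq_abs, abs_of_nonneg (sq_nonneg ‖p - q‖)]
    refine h.trans ?_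
    rw [mul_assoc]
    exact mul_le_mul_of_nonneg_left e2 (by positivity)
  have h0 := hO.hasFDerivAt (𝕜 := ℝ) one_lt_two
  have h1 : HasFDerivAt (fun p => V + (L p - L q)) L q := (L.hasFDerivAt.sub_const _).const_add V
  refine ((h0.add h1).congr_fderiv (zero_add L)).congr_of_eventuallyEq
    (Eventually.of_forall fun p => ?_)
  simp only [Pi.add_apply, map_sub]
  ring

theorem exists_particleDeriv_entropicFSD (hne : ∀ i j, q i ≠ q' j) {χ : ℝ} (hχ : 0 < χ) :
    DifferentiableAt ℝ (fun p => entropicFSD χ p q') q ∧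
    ∃ P ∈ couplings (fun _ : Fin N => (N : ℝ)⁻¹) fun _ : Fin N => (N : ℝ)⁻¹,
      (∀ Q ∈ couplings (fun _ : Fin N => (N : ℝ)⁻¹) fun _ : Fin N => (N : ℝ)⁻¹,
        planObjective χ (Matrix.of fun i j => max (q' j - q i) 0) P ≤
          planObjective χ (Matrix.of fun i j => max (q' j - q i) 0) Q) ∧
      ∀ i, particleDeriv (fun p => entropicFSD χ p q') q i =
        -∑ j, P i j * (if q i < q' j then (1 : ℝ) else 0) := by
  obtain ⟨P, hP, -, hmin⟩ := exists_entropicOT_eq (fun i => inv_natCast_le_one i)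
    uniformCouplings_nonempty χ (Matrix.of fun i j : Fin N => max (q' j - q i) 0)
  have h := hasFDerivAt_entropicFSD hne hχ hP hmin
  refine ⟨h.differentiableAt, P, hP, hmin, fun i => ?_⟩
  rw [particleDeriv_eq h i]
  simp [Pi.single_apply]

theorem eventually_strictMono (hq : StrictMono q) : ∀ᶠ p in 𝓝 q, StrictMono p := by
  have : ∀ᶠ p : Fin N → ℝ in 𝓝 q, ∀ i j, i < j → p i < p j := by
    rw [eventually_all]; intro i
    rw [eventually_all]; intro j
    rw [eventually_imp_distrib_left]
    intro hij
    exact (continuous_apply i).continuousAt.eventually_lt (continuous_apply j).continuousAt (hq hij)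
  exact this.mono fun p hp i j hij => hp i j hij

/-- As the regularisation vanishes, the row sums of the optimal plan over the dominated targets
converge to those of the monotone coupling. -/
theorem tendsto_particleDeriv_entropicFSD (hne : ∀ i j, q i ≠ q' j) (hq : StrictMono q)
    (hq' : Monotone q') (i : Fin N) :
    Tendsto (fun χ => particleDeriv (fun p => entropicFSD χ p q') q i) (𝓝[>] 0)
      (𝓝 (-((N : ℝ)⁻¹ * (if q i < q' i then (1 : ℝ) else 0)))) := by
  have hcont : ∀ σ : ℝ, Tendsto (fun s : ℝ => Function.update q i (q i + σ * s)) (𝓝[>] 0) (𝓝 q) := by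
    intro σ
    have hc : Continuous fun s : ℝ => Function.update q i (q i + σ * s) :=
      continuous_const.update i (by fun_prop)
    have := hc.tendsto 0
    simp only [mul_zero, add_zero, Function.update_eq_self] at this
    exact this.mono_left nhdsWithin_le_nhds
  have hev := (eventually_cost_affine hne).and (eventually_strictMono hq)
  -- One step `s`, independent of `χ`, keeps the particles sorted and the cost affine in both
  -- directions of coordinate `i`.
  obtain ⟨s, ⟨h1, h2⟩, hs : 0 < s⟩ := (((hcont 1).eventually hev).and
    ((hcont (-1)).eventually hev)).and self_mem_nhdsWithin |>.exists
  -- Compare `P` with the monotone coupling at the shifted particles, where the latter is still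
  -- optimal. The shift changes the two costs by multiples of their row masses, so the discrepancy
  -- is bounded by the excess cost of `P` at `q`.
  have key : ∀ (σ : ℝ), ((∀ k j, max (q' j - Function.update q i (q i + σ * s) k) 0 =
      max (q' j - q k) 0 - (Function.update q i (q i + σ * s) k - q k) *
        (if q k < q' j then (1 : ℝ) else 0)) ∧
        StrictMono (Function.update q i (q i + σ * s))) →
      ∀ P ∈ couplings (fun _ : Fin N => (N : ℝ)⁻¹) fun _ : Fin N => (N : ℝ)⁻¹,
      (σ * s) * (∑ j, P i j * (if q i < q' j then (1 : ℝ) else 0) -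
        (N : ℝ)⁻¹ * (if q i < q' i then (1 : ℝ) else 0)) ≤
      ∑ k, ∑ j, P k j * max (q' j - q k) 0 - ∑ k, (N : ℝ)⁻¹ * max (q' k - q k) 0 := by
    intro σ hσ P hP
    have h := sum_diag_le_of_mem_couplings hσ.2.monotone hq' hP
    simp only [hσ.1, mul_sub, Finset.sum_sub_distrib] at h
    have e1 : ∀ F : Fin N → ℝ, ∑ k, (Function.update q i (q i + σ * s) k - q k) * F k =
        σ * s * F i := by
      intro F
      rw [Finset.sum_eq_single i]
      · rw [Function.update_self]; ring
      · intro k _ hk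
        rw [Function.update_of_ne hk]; ring
      · simp
    have e2 := e1 fun k => (N : ℝ)⁻¹ * (if q k < q' k then (1 : ℝ) else 0)
    have e3 := e1 fun k => ∑ j, P k j * (if q k < q' j then (1 : ℝ) else 0)
    have e4 : ∑ k, (N : ℝ)⁻¹ * ((Function.update q i (q i + σ * s) k - q k) *
        (if q k < q' k then (1 : ℝ) else 0)) = ∑ k, (Function.update q i (q i + σ * s) k - q k) *
        ((N : ℝ)⁻¹ * (if q k < q' k then (1 : ℝ) else 0)) :=
      Finset.sum_congr rfl fun k _ => by ring
    have e5 : ∑ k, ∑ j, P k j * ((Function.update q i (q i + σ * s) k - q k) *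
        (if q k < q' j then (1 : ℝ) else 0)) = ∑ k, (Function.update q i (q i + σ * s) k - q k) *
        ∑ j, P k j * (if q k < q' j then (1 : ℝ) else 0) :=
      Finset.sum_congr rfl fun k _ => by
        rw [Finset.mul_sum]
        exact Finset.sum_congr rfl fun j _ => by ring
    rw [e4, e5, e2, e3] at h
    linarith
  have hbound : ∀ χ > 0, |particleDeriv (fun p => entropicFSD χ p q') q i -
      -((N : ℝ)⁻¹ * (if q i < q' i then (1 : ℝ) else 0))| ≤ χ * (N * N) / s := by
    intro χ hχ
    obtain ⟨-, P, hP, hmin, hd⟩ := exists_particleDeriv_entropicFSD hne hχ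
    have hD : Matrix.diagonal (fun _ : Fin N => (N : ℝ)⁻¹) ∈
      couplings (fun _ : Fin N => (N : ℝ)⁻¹) fun _ : Fin N => (N : ℝ)⁻¹ :=
      diagonal_mem_couplings (by positivity)
    have h3 := hmin _ hD
    -- Minimality of `P` against the diagonal plan and the entropy bounds give excess cost at most
    -- `χ N²`; `σ = ±1` then gives both sides of the estimate.
    have hle : ∀ _ : Fin N, (N : ℝ)⁻¹ ≤ 1 := fun i => inv_natCast_le_one i
    have h4 := (planEntropy_mem_Icc hle hP).2
    have h5 := (planEntropy_mem_Icc hle hD).1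
    have e : ∑ k, ∑ j, Matrix.diagonal (fun _ : Fin N => (N : ℝ)⁻¹) k j * max (q' j - q k) 0 =
        ∑ k, (N : ℝ)⁻¹ * max (q' k - q k) 0 := by
      refine Finset.sum_congr rfl fun k _ => ?_
      simp [Matrix.diagonal_apply]
    simp only [planObjective, Matrix.of_apply, e] at h3
    have h6 := key 1 h1 P hP
    have h7 := key (-1) h2 P hP
    have h8 := mul_le_mul_of_nonneg_left h4 hχ.le
    have h9 := mul_nonneg hχ.le h5
    have h10 : ∀ X : ℝ, |X| * s = |X * s| := fun X => by rw [abs_mul, abs_of_pos hs]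
    rw [hd i, le_div_iff₀ hs, h10, abs_le]
    constructor <;> linarith
  rw [tendsto_iff_dist_tendsto_zero]
  have hz : Tendsto (fun χ : ℝ => χ * (N * N) / s) (𝓝[>] 0) (𝓝 0) := by
    have : Continuous fun χ : ℝ => χ * (N * N) / s := by fun_prop
    have := this.tendsto 0
    simp only [zero_mul, zero_div] at this
    exact this.mono_left nhdsWithin_le_nhds
  refine squeeze_zero' (Eventually.of_forall fun _ => dist_nonneg) ?_ hz
  filter_upwards [self_mem_nhdsWithin] with χ hχ
  rw [Real.dist_eq]
  exact hbound χ hχ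

end EntropicParticles

/-! ### The weighted objective on empirical measures -/

section Empirical

variable {N : ℕ}

theorem isProbabilityMeasure_empirical (hN : 0 < N) (p : Fin N → ℝ) :
    IsProbabilityMeasure (empirical p) := by
  refine ⟨?_⟩
  simp only [empirical, Measure.smul_apply, Measure.finsetSum_apply, measure_univ,
    Finset.sum_const, Finset.card_univ, Fintype.card_fin, smul_eq_mul, nsmul_eq_mul, mul_one]
  exact ENNReal.inv_mul_cancel (by exact_mod_cast hN.ne') (by simp)

theorem cdf_empirical (hN : 0 < N) (p : Fin N → ℝ) (t : ℝ) :
    cdf (empirical p) t = (Finset.univ.filter fun i => p i ≤ t).card / N := by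
  have := isProbabilityMeasure_empirical hN p
  rw [cdf_eq_real, Measure.real]
  simp only [empirical, Measure.smul_apply, Measure.finsetSum_apply,
    Measure.dirac_apply' _ measurableSet_Iic, Set.indicator_apply, Set.mem_Iic, Pi.one_apply,
    smul_eq_mul]
  rw [Finset.sum_boole, ENNReal.toReal_mul, ENNReal.toReal_inv]
  simp
  ring

/-- With indices from `0`, at most `i` particles lie at or below a point less than `p i`, and at
least `i + 1` at or below `p i`. The cell is closed on the right because the quantile is
left-continuous. -/
theorem quantile_empirical (hN : 0 < N) {p : Fin N → ℝ} (hp : Monotone p) (i : Fin N) {u : ℝ}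
    (hu : u ∈ Set.Ioc ((i : ℝ) / N) (((i : ℝ) + 1) / N)) : quantile (empirical p) u = p i := by
  have hN' : (0 : ℝ) < N := by exact_mod_cast hN
  have hset : {t : ℝ | u ≤ cdf (empirical p) t} = Set.Ici (p i) := by
    ext t
    simp only [Set.mem_ofPred_eq, Set.mem_Ici, cdf_empirical hN]
    constructor
    · intro h
      by_contra hlt
      rw [not_le] at hlt
      have hsub : (Finset.univ.filter fun k => p k ≤ t) ⊆ Finset.Iio i := by
        intro k hk
        rw [Finset.mem_filter] at hk
        rw [Finset.mem_Iio]
        by_contra hik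
        exact absurd (hp (not_lt.1 hik)) (not_le.2 (hk.2.trans_lt hlt))
      have hcard := Finset.card_le_card hsub
      rw [Fin.card_Iio] at hcard
      have : ((Finset.univ.filter fun k => p k ≤ t).card : ℝ) / N ≤ (i : ℝ) / N :=
        div_le_div_of_nonneg_right (by exact_mod_cast hcard) hN'.le
      linarith [hu.1]
    · intro h
      have hsub : Finset.Iic i ⊆ (Finset.univ.filter fun k => p k ≤ t) := by
        intro k hk
        rw [Finset.mem_Iic] at hk
        exact Finset.mem_filter.2 ⟨Finset.mem_univ _, (hp hk).trans h⟩
      have hcard := Finset.card_le_card hsub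
      rw [Fin.card_Iic] at hcard
      refine hu.2.trans (div_le_div_of_nonneg_right ?_ hN'.le)
      exact_mod_cast hcard
  rw [quantile, hset, csInf_Ici]

theorem weightedFSD_empirical (hN : 0 < N) {w : ℝ → ℝ}
    (hw : IntervalIntegrable w volume 0 1) {p r : Fin N → ℝ} (hp : Monotone p) (hr : Monotone r) :
    weightedFSD w (empirical p) (empirical r) =
      ∑ i : Fin N, (∫ u in ((i : ℝ) / N)..(((i : ℝ) + 1) / N), w u) * max (r i - p i) 0 := by
  have hN' : (0 : ℝ) < N := by exact_mod_cast hN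
  have hle : ∀ k : ℕ, (k : ℝ) / N ≤ ((k : ℝ) + 1) / N := fun k =>
    div_le_div_of_nonneg_right (by linarith) hN'.le
  have hwk : ∀ k < N, IntervalIntegrable w volume ((k : ℝ) / N) (((k : ℝ) + 1) / N) := by
    intro k hk
    refine hw.mono_set ?_
    rw [Set.uIcc_of_le (hle k), Set.uIcc_of_le zero_le_one]
    refine Set.Icc_subset_Icc (by positivity) ((div_le_one hN').2 ?_)
    exact_mod_cast hk
  have hcell : ∀ i : Fin N, ∀ u ∈ Set.Ioc ((i : ℝ) / N) (((i : ℝ) + 1) / N),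
      w u * max (quantile (empirical r) u - quantile (empirical p) u) 0 =
        w u * max (r i - p i) 0 := fun i u hu => by
    rw [quantile_empirical hN hp i hu, quantile_empirical hN hr i hu]
  have hint : ∀ k < N, IntervalIntegrable
      (fun u => w u * max (quantile (empirical r) u - quantile (empirical p) u) 0) volume
      ((k : ℝ) / N) (((k + 1 : ℕ) : ℝ) / N) := by
    intro k hk
    push_cast
    refine ((hwk k hk).mul_const (max (r ⟨k, hk⟩ - p ⟨k, hk⟩) 0)).congr ?_
    intro u hu
    rw [Set.uIoc_of_le (hle k)] at hu
    exact (hcell ⟨k, hk⟩ u hu).symm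
  have h := intervalIntegral.sum_integral_adjacent_intervals (a := fun k : ℕ => (k : ℝ) / N) hint
  simp only [Nat.cast_zero, zero_div, div_self hN'.ne'] at h
  rw [weightedFSD, ← h, Finset.sum_range]
  refine Finset.sum_congr rfl fun i _ => ?_
  push_cast
  rw [← intervalIntegral.integral_mul_const]
  refine intervalIntegral.integral_congr_ae (Eventually.of_forall fun u hu => ?_)
  rw [Set.uIoc_of_le (hle i)] at hu
  exact hcell i u hu

/-- Strict order survives small perturbations, so the cell formula holds near `q`; there it is
affine in the particles. -/
theorem hasFDerivAt_weightedFSD (hN : 0 < N) {w : ℝ → ℝ} (hw : IntervalIntegrable w volume 0 1)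
    {q q' : Fin N → ℝ} (hne : ∀ i j, q i ≠ q' j) (hq : StrictMono q) (hq' : Monotone q') :
    HasFDerivAt (fun p => weightedFSD w (empirical p) (empirical q'))
      (-∑ i : Fin N, ((∫ u in ((i : ℝ) / N)..(((i : ℝ) + 1) / N), w u) *
        (if q i < q' i then (1 : ℝ) else 0)) •
          ContinuousLinearMap.proj (R := ℝ) (φ := fun _ : Fin N => ℝ) i) q := by
  set L : (Fin N → ℝ) →L[ℝ] ℝ := -∑ i : Fin N,
    ((∫ u in ((i : ℝ) / N)..(((i : ℝ) + 1) / N), w u) *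
      (if q i < q' i then (1 : ℝ) else 0)) •
        ContinuousLinearMap.proj (R := ℝ) (φ := fun _ : Fin N => ℝ) i with hL
  have h1 : HasFDerivAt (fun p => (∑ i : Fin N,
      (∫ u in ((i : ℝ) / N)..(((i : ℝ) + 1) / N), w u) * max (q' i - q i) 0) + (L p - L q)) L q :=
    (L.hasFDerivAt.sub_const _).const_add _
  refine h1.congr_of_eventuallyEq ?_
  filter_upwards [eventually_cost_affine hne, eventually_strictMono hq] with p hp hpm
  rw [weightedFSD_empirical hN hw hpm.monotone hq', ← map_sub]
  simp only [hL, hp, neg_apply, sum_apply, smul_apply, ContinuousLinearMap.proj_apply,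
    Pi.sub_apply, smul_eq_mul]
  rw [← Finset.sum_neg_distrib, ← Finset.sum_add_distrib]
  exact Finset.sum_congr rfl fun i _ => by ring

end Empirical

theorem quantile_le_quantile {μ : Measure ℝ} {a b : ℝ} (ha : a ∈ Set.Ioo (0 : ℝ) 1)
    (hb : b ∈ Set.Ioo (0 : ℝ) 1) (hab : a ≤ b) : quantile μ a ≤ quantile μ b :=
  (quantile_le_iff ha _).2 (hab.trans ((quantile_le_iff hb _).1 le_rfl))

/-! ### Chain rule for the Lagrangian and the final assembly -/

namespace Problem

variable {d N : ℕ} {𝒳 𝒴 : Type*} [MeasurableSpace 𝒳] [MeasurableSpace 𝒴]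
  {S : Problem d N 𝒳 𝒴} {θ₀ : EuclideanSpace ℝ (Fin d)}

/-- Strictly ordered particles of one policy force the levels to increase strictly, which sorts the
particles of every other policy. -/
theorem monotone_particles_of_strictMono {p : Policy 𝒳 S.base} (h : StrictMono (S.particles p))
    (r : Policy 𝒳 S.base) : Monotone (S.particles r) := by
  have hl : StrictMono S.level := by
    intro i j hij
    by_contra hn
    exact absurd (quantile_le_quantile (μ := S.costLaw p) (S.level_mem j) (S.level_mem i)
      (not_lt.1 hn)) (not_le.2 (h hij))
  exact fun i j hij => quantile_le_quantile (S.level_mem i) (S.level_mem j) (hl.monotone hij)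

/-- Dividing the particle gradient by `f i` restores the factor missing from the density-free
gradient, so the latter becomes the true chain rule. -/
theorem RegularAt.hasGradientAt_lagrangian (h : S.RegularAt θ₀) {Φ : (Fin N → ℝ) → ℝ}
    (hΦ : DifferentiableAt ℝ Φ (S.particles (S.policy θ₀))) (lam : ℝ) {f : Fin N → ℝ}
    (hf : ∀ i, 0 < f i ∧ HasDerivAt (fun t => cdf (S.costLaw (S.policy θ₀)) t) (f i)
      (S.particles (S.policy θ₀) i)) :
    HasGradientAt (S.lagrangian Φ lam) (S.estimator lam
      (fun i => particleDeriv Φ (S.particles (S.policy θ₀)) i / f i) θ₀) θ₀ := by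
  rw [← h.densityFreeGradient_eq_estimator, hasGradientAt_iff_hasFDerivAt]
  have hp : HasFDerivAt (fun θ => S.particles (S.policy θ)) (ContinuousLinearMap.pi fun i =>
      InnerProductSpace.toDual ℝ _ (-((f i)⁻¹ • S.cdfGradient θ₀ i))) θ₀ :=
    hasFDerivAt_pi.2 fun i => (h.hasGradientAt_particles i (hf i).1 (hf i).2).hasFDerivAt
  have hr := h.hasGradientAt_expectedReward
  have hc := hr.hasFDerivAt.add (((hΦ.hasFDerivAt.comp θ₀ hp).sub_const S.κ).const_mul lam)
  refine hc.congr_fderiv ?_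
  ext v
  rw [densityFreeGradient, hr.gradient]
  set L := fderiv ℝ Φ (S.particles (S.policy θ₀)) with hL
  have hLv : ∀ x : Fin N → ℝ, L x =
      ∑ i, x i * particleDeriv Φ (S.particles (S.policy θ₀)) i := by
    intro x
    simp only [particleDeriv_eq hΦ.hasFDerivAt, ← hL]
    conv_lhs => rw [← Finset.univ_sum_single x, map_sum]
    refine Finset.sum_congr rfl fun i _ => ?_
    rw [← smul_eq_mul, ← map_smul, ← Pi.single_smul, smul_eq_mul, mul_one]
  simp only [add_apply, smul_apply, ContinuousLinearMap.comp_apply, hLv,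
    ContinuousLinearMap.pi_apply, InnerProductSpace.toDual_apply_apply, smul_eq_mul, map_add,
    inner_smul_left, sum_inner, inner_neg_left, conj_trivial]
  congr 2
  refine Finset.sum_congr rfl fun i _ => ?_
  rw [div_eq_mul_inv]
  ring

theorem tendsto_densityFreeGradient {ι : Type*} {l : Filter ι} {g : ι → Fin N → ℝ}
    {g₀ : Fin N → ℝ} (lam : ℝ) (hg : ∀ i, Tendsto (fun χ => g χ i) l (𝓝 (g₀ i))) :
    Tendsto (fun χ => S.densityFreeGradient lam (g χ) θ₀) l
      (𝓝 (S.densityFreeGradient lam g₀ θ₀)) :=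
  (tendsto_const_nhds.add ((tendsto_finsetSum _ fun i _ =>
    (hg i).smul_const _).const_smul lam))

theorem densityFreeGradient_sub (lam : ℝ) (g g' : Fin N → ℝ) :
    S.densityFreeGradient lam g θ₀ - S.densityFreeGradient lam g' θ₀ =
      lam • ∑ i, (g' i - g i) • S.cdfGradient θ₀ i := by
  simp only [densityFreeGradient]
  rw [add_sub_add_left_eq_sub, ← smul_sub, ← Finset.sum_sub_distrib]
  congr 1
  refine Finset.sum_congr rfl fun i _ => ?_
  rw [smul_neg, smul_neg, sub_smul]
  abel

end Problem

end RAD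

theorem theorem1 {d N : ℕ} (hN : 0 < N) {𝒳 𝒴 : Type*} [MeasurableSpace 𝒳] [MeasurableSpace 𝒴]
    (S : RAD.Problem d N 𝒳 𝒴) (lam : ℝ) (hlam : 0 ≤ lam)
    (w : ℝ → ℝ) (hw : ∀ u ∈ Set.Icc (0 : ℝ) 1, 0 ≤ w u) (hw1 : ∫ u in (0 : ℝ)..1, w u = 1)
    (θ₀ : EuclideanSpace ℝ (Fin d)) (hreg : S.RegularAt θ₀)
    -- the particles of the current policy and of the reference policy
    (q : Fin N → ℝ) (hq : q = S.particles (S.policy θ₀))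
    (q' : Fin N → ℝ) (hq' : q' = S.particles S.ref)
    (hne : ∀ i j, q i ≠ q' j)
    -- the entropic and the weighted particle objectives
    (Φ : ℝ → (Fin N → ℝ) → ℝ) (hΦ : Φ = fun χ p => RAD.entropicFSD χ p q')
    (Ψ : (Fin N → ℝ) → ℝ)
    (hΨ : Ψ = fun p => RAD.weightedFSD w (RAD.empirical p) (RAD.empirical q')) :
    -- all derivatives exist and all expectations converge
    DifferentiableAt ℝ S.expectedReward θ₀ ∧
    (∀ i, DifferentiableAt ℝ (fun θ => cdf (S.costLaw (S.policy θ)) (q i)) θ₀) ∧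
    (∀ χ > 0, DifferentiableAt ℝ (Φ χ) q) ∧
    (∀ g : Fin N → ℝ, Integrable (S.estimatorIntegrand lam g θ₀) (S.joint (S.policy θ₀))) ∧
    -- the density-free gradient has the REINFORCE form, unweighted and weighted
    (∀ χ > 0,
      S.densityFreeGradient lam (RAD.particleDeriv (Φ χ) q) θ₀ =
        S.estimator lam (RAD.particleDeriv (Φ χ) q) θ₀ ∧
      S.densityFreeGradient lam (fun i => w (S.level i) * RAD.particleDeriv (Φ χ) q i) θ₀ =
        S.estimator lam (fun i => w (S.level i) * RAD.particleDeriv (Φ χ) q i) θ₀) ∧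
    -- the exact gradients when the cost has a positive density at the quantiles, and the error
    -- made by dropping that density
    (∀ f : Fin N → ℝ,
      (∀ i, 0 < f i ∧ HasDerivAt (fun t => cdf (S.costLaw (S.policy θ₀)) t) (f i) (q i)) →
      (∀ i, HasGradientAt (fun θ => S.particles (S.policy θ) i)
        (-((f i)⁻¹ • S.cdfGradient θ₀ i)) θ₀) ∧
      (∀ χ > 0,
        HasGradientAt (S.lagrangian (Φ χ) lam)
          (S.estimator lam (fun i => RAD.particleDeriv (Φ χ) q i / f i) θ₀) θ₀ ∧
        gradient (S.lagrangian (Φ χ) lam) θ₀ - S.estimator lam (RAD.particleDeriv (Φ χ) q) θ₀ =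
          lam • ∑ i, (RAD.particleDeriv (Φ χ) q i * (1 - (f i)⁻¹)) • S.cdfGradient θ₀ i) ∧
      (StrictMono q →
        HasGradientAt (S.lagrangian Ψ lam)
          (S.estimator lam (fun i => RAD.particleDeriv Ψ q i / f i) θ₀) θ₀)) ∧
    -- the weighted estimator as the regularisation vanishes: the density-free gradient of the
    -- weighted Lagrangian, up to replacing the averages of `w` over the cells by its values
    (StrictMono q →
      DifferentiableAt ℝ Ψ q ∧
      Tendsto
        (fun χ => S.estimator lam (fun i => w (S.level i) * RAD.particleDeriv (Φ χ) q i) θ₀)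
        (𝓝[>] 0)
        (𝓝 (S.densityFreeGradient lam (RAD.particleDeriv Ψ q) θ₀ +
          lam • ∑ i : Fin N,
            ((w (S.level i) / N - ∫ u in ((i : ℝ) / N)..(((i : ℝ) + 1) / N), w u) *
              (if q i < q' i then (1 : ℝ) else 0)) • S.cdfGradient θ₀ i))) := by
  subst hΦ hΨ
  have hw01 : IntervalIntegrable w volume 0 1 := by
    -- Integrability of `w` is implicit in `hw1`: otherwise the integral would default to `0`.
    by_contra hn
    rw [intervalIntegral.integral_undef hn] at hw1
    exact zero_ne_one hw1
  have hΦd : ∀ χ > 0, DifferentiableAt ℝ (fun p => RAD.entropicFSD χ p q') q := fun χ hχ =>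
    (RAD.exists_particleDeriv_entropicFSD hne hχ).1
  have hmono : StrictMono q → Monotone q' := by
    intro h
    rw [hq] at h
    rw [hq']
    exact RAD.Problem.monotone_particles_of_strictMono h _
  have hΨd := fun h : StrictMono q => RAD.hasFDerivAt_weightedFSD hN hw01 hne h (hmono h)
  refine ⟨hreg.hasGradientAt_expectedReward.differentiableAt,
    fun i => (hreg.hasGradientAt_cdf _).differentiableAt, hΦd,
    hreg.integrable_estimatorIntegrand lam,
    fun χ _ => ⟨hreg.densityFreeGradient_eq_estimator _ _,
      hreg.densityFreeGradient_eq_estimator _ _⟩, fun f hf => ?_, fun h => ?_⟩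
  · have hL : ∀ Θ : (Fin N → ℝ) → ℝ, DifferentiableAt ℝ Θ q →
        HasGradientAt (S.lagrangian Θ lam)
          (S.estimator lam (fun i => RAD.particleDeriv Θ q i / f i) θ₀) θ₀ := by
      subst hq
      exact fun Θ hΘ => hreg.hasGradientAt_lagrangian hΘ lam hf
    refine ⟨fun i => ?_, fun χ hχ => ⟨hL _ (hΦd χ hχ), ?_⟩,
      fun h => hL _ (hΨd h).differentiableAt⟩
    · subst hq
      exact hreg.hasGradientAt_particles i (hf i).1 (hf i).2
    · rw [(hL _ (hΦd χ hχ)).gradient, ← hreg.densityFreeGradient_eq_estimator,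
        ← hreg.densityFreeGradient_eq_estimator, RAD.Problem.densityFreeGradient_sub]
      simp only [div_eq_mul_inv, mul_sub, mul_one]
  · refine ⟨(hΨd h).differentiableAt, ?_⟩
    simp only [← hreg.densityFreeGradient_eq_estimator]
    have hlim := RAD.Problem.tendsto_densityFreeGradient (S := S) (θ₀ := θ₀) lam fun i =>
      (RAD.tendsto_particleDeriv_entropicFSD hne h (hmono h) i).const_mul (w (S.level i))
    convert hlim using 2
    -- The limiting particle gradient has `w(α_i)/N` where that of the weighted objective has the
    -- cell integral of `w`; by linearity in `g` their difference is the correction term.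
    rw [add_comm, ← eq_sub_iff_add_eq, RAD.Problem.densityFreeGradient_sub]
    congr 1
    refine Finset.sum_congr rfl fun i _ => ?_
    congr 1
    rw [RAD.particleDeriv_eq (hΨd h)]
    simp only [neg_apply, sum_apply, smul_apply, ContinuousLinearMap.proj_apply, smul_eq_mul]
    rw [Finset.sum_eq_single i]
    · rw [Pi.single_eq_same]
      ring
    · intro k _ hk
      rw [Pi.single_eq_of_ne hk, mul_zero]
    · simp
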